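/- All graphs are finite and simple. For a graph $G$ write $v(G)$, $e(G)$ for its numbers of vertices and edges, and $\rho(G)=2e(G)/v(G)^2$ for its edge density. A graph is $\mathcal F$-free if it contains no member of the family $\mathcal F$ as a (not necessarily induced) subgraph; $\mathrm{ex}_\rho(n,\mathrm{Forb}(\mathcal F))$ is the maximum of $\rho(G)$ over all $\mathcal F$-free graphs $G$ with $n$ vertices. For graphs $G,H$ with vertex sets $\{x_1,\dots,x_m\}$ and $\{y_1,\dots,y_n\}$, let $$\delta_1(G,H)=\min_A\sum_{(i,j,g,h)\in\triangle}\alpha_{i,g}\,\alpha_{j,h},$$ where the minimum is over all non-negative $m\times n$ matrices $A=(\alpha_{i,g})$ with all row sums $1/m$ and all column sums $1/n$, and $\triangle$ is the set of quadruples $(i,j,g,h)\in[m]^2\times[n]^2$ for which exactly one of $\{x_i,x_j\}\in E(G)$ and $\{y_g,y_h\}\in E(H)$ holds. **Theorem 1 (Erdős–Simonovits Stability Theorem).** Let $\mathcal F$ be a (possibly infinite) family of graphs each of which has at least one edge. Then: (i) The extremal $(\rho,\mathrm{Forb}(\mathcal F))$-problem is stable: for every $\varepsilon>0$ there are $\varepsilon'>0$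 and $n_0$ such that for all $n_1,n_2\ge n_0$ and all $\mathcal F$-free graphs $G_1,G_2$ with $v(G_i)=n_i$ and $\rho(G_i)\ge \mathrm{ex}_\rho(n_i,\mathrm{Forb}(\mathcal F))-\varepsilon'$ for $i=1,2$, we have $\delta_1(G_1,G_2)<\varepsilon$. (ii) If $\mathcal F\neq\emptyset$, then $r=\min\{\chi(F): F\in\mathcal F\}-1$ satisfies $r\ge 1$, and for every $\varepsilon>0$ there are $\varepsilon'>0$ and $n_0$ such that every $\mathcal F$-free graph with $n\ge n_0$ vertices and at least $\left(\frac{r-1}{r}-\varepsilon'\right)\binom n2$ edges can be made isomorphic to the Turán graph $T_r(n)$ (the complete $r$-partite graph on $n$ vertices with parts of size $\lfloor n/r\rfloor$ or $\lceil n/r\rceil$) by changing at most $\varepsilon\binom n2$ adjacencies. -/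

import Mathlib

open Finset

universe u v w

/-- A graph parameter: a real-valued function on finite graphs that respects isomorphism. -/
structure GraphParameter where
  /-- The value of the parameter on a finite graph. -/
  val : ∀ (V : Type u) [Fintype V], SimpleGraph V → ℝ
  /-- Isomorphic graphs have the same value. -/
  val_eq_of_iso : ∀ (V V' : Type u) [Fintype V] [Fintype V']
    (G : SimpleGraph V) (G' : SimpleGraph V'), Nonempty (G ≃g G') → val V G = val V' G'

/-- A graph property: a family of finite graphs closed under isomorphism. -/
structure GraphProperty where
  /-- Membership of a finite graph in the family. -/
  Holds : ∀ (V : Type u) [Fintype V], SimpleGraph V → Prop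
  /-- The family is closed under isomorphism. -/
  holds_of_iso : ∀ (V V' : Type u) [Fintype V] [Fintype V']
    (G : SimpleGraph V) (G' : SimpleGraph V'), Nonempty (G ≃g G') → Holds V G → Holds V' G'

/-- `ex_f(n, P)`: the maximum of `f` over the graphs of order `n` with property `P`.
By invariance under isomorphism only finitely many values occur, so the supremum is
a maximum as soon as there is a graph of order `n` with property `P`. -/
noncomputable def extremalValue (f : GraphParameter.{u}) (P : GraphProperty.{u}) (n : ℕ) : ℝ :=
  sSup {x : ℝ | ∃ (V : Type u) (_ : Fintype V) (G : SimpleGraph V),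
    Fintype.card V = n ∧ P.Holds V G ∧ f.val V G = x}

/-- Fractional overlays of the vertex sets `V` and `W`: non-negative matrices with all row sums
`1 / |V|` and all column sums `1 / |W|`. -/
def IsFractionalOverlay {V : Type v} {W : Type w} [Fintype V] [Fintype W]
    (A : V → W → ℝ) : Prop :=
  (∀ i g, 0 ≤ A i g) ∧
  (∀ i, ∑ g, A i g = 1 / (Fintype.card V : ℝ)) ∧
  (∀ g, ∑ i, A i g = 1 / (Fintype.card W : ℝ))

open Classical in
/-- The cost `δ₁(G, H, A)`: the sum of `A i g * A j h` over all quadruples `(i, j, g, h)` such that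
exactly one of `i ~ j` in `G` and `g ~ h` in `H` holds. -/
noncomputable def overlayCost {V : Type v} {W : Type w} [Fintype V] [Fintype W]
    (G : SimpleGraph V) (H : SimpleGraph W) (A : V → W → ℝ) : ℝ :=
  ∑ i, ∑ j, ∑ g, ∑ h, if Xor (G.Adj i j) (H.Adj g h) then A i g * A j h else 0

/-- The `δ₁`-distance (fractional edit distance) of two finite graphs: the minimum cost of
a fractional overlay. For non-empty vertex sets the infimum is attained, since the overlays form
a non-empty compact set on which the cost is continuous. -/
noncomputable def deltaOne {V : Type v} {W : Type w} [Fintype V] [Fintype W]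
    (G : SimpleGraph V) (H : SimpleGraph W) : ℝ :=
  sInf {x : ℝ | ∃ A : V → W → ℝ, IsFractionalOverlay A ∧ overlayCost G H A = x}

/-- The extremal `(f, P)`-problem is stable: any two almost extremal graphs of large
(possibly different) orders are close in the `δ₁`-distance. -/
def IsStableProblem (f : GraphParameter.{u}) (P : GraphProperty.{u}) : Prop :=
  ∀ ε : ℝ, 0 < ε → ∃ ε' : ℝ, 0 < ε' ∧ ∃ n₀ : ℕ,
    ∀ (V₁ V₂ : Type u) [Fintype V₁] [Fintype V₂] (G₁ : SimpleGraph V₁) (G₂ : SimpleGraph V₂),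
      n₀ ≤ Fintype.card V₁ → n₀ ≤ Fintype.card V₂ →
      P.Holds V₁ G₁ → P.Holds V₂ G₂ →
      extremalValue f P (Fintype.card V₁) - ε' ≤ f.val V₁ G₁ →
      extremalValue f P (Fintype.card V₂) - ε' ≤ f.val V₂ G₂ →
      deltaOne G₁ G₂ < ε

/-- The edge density `ρ(G) = 2 e(G) / v(G)²`. -/
noncomputable def edgeDensity : GraphParameter.{u} where
  val V _ G := 2 * (G.edgeSet.ncard : ℝ) / (Fintype.card V : ℝ) ^ 2
  val_eq_of_iso := by
    rintro V V' _ _ G G' ⟨e⟩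
    have h : G.edgeSet.ncard = G'.edgeSet.ncard := Nat.card_congr e.mapEdgeSet
    rw [h, Fintype.card_congr e.toEquiv]

/-- `G` is `F`-free: it contains no member of the family `F` as a (not necessarily induced)
subgraph. -/
def IsFamilyFree {ι : Type w} {W : ι → Type v} (F : ∀ i, SimpleGraph (W i))
    {V : Type u} (G : SimpleGraph V) : Prop :=
  ∀ i, (F i).Free G

/-- `Forb(F)`: the property of being `F`-free. -/
def Forb {ι : Type w} {W : ι → Type v} (F : ∀ i, SimpleGraph (W i)) : GraphProperty.{u} where
  Holds _ _ G := IsFamilyFree F G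
  holds_of_iso := by
    rintro V V' _ _ G G' ⟨e⟩ h i
    exact (SimpleGraph.free_congr_right e).1 (h i)

/-! Write K_k(s) for the complete k-partite graph with parts of size s. The core is
`exists_close_to_turanGraph`: a large graph of density at least about 1 - 1/r without K_{r+1}(s) is
close to the Turán graph. Let r + 1 be the least chromatic number in the family. A member attaining
it embeds in some K_{r+1}(s), so free graphs contain no such K_{r+1}(s), which gives (ii). The Turán
graph is r-colourable, hence free, so almost extremal graphs have density near 1 - 1/r and the core
applies to them. Two Turán graphs with r parts overlay almost perfectly, and a triangle inequality
gives (i). For the empty family, almost extremal graphs are almost complete.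

The core goes as follows. By Erdős–Stone, few vertices have degree well below (1 - 1/r)n
(`exists_card_low_degree_le`), and for r ≥ 2 there is a K_r(t), with t much larger than s, avoiding
them (`exists_parts_disjoint`). Few vertices have s neighbours in each of its parts, as otherwise
K_{r+1}(s) appears (`card_rich_le`). So almost every vertex has fewer than s neighbours in some
part, which becomes its colour, and double counting the edges to K_r(t) shows that it sees almost
all of the other parts (`exists_coloring_of_parts`). A K_{s,s} among such vertices of one colour
would extend to K_{r+1}(s) through common neighbours in the other parts, so colour classes are
sparse. With so few monochromatic edges, density near 1 - 1/r forces nearly equal classes, by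
convexity, and almost all edges between them (`exists_equiv_sum_abs_le`). -/

namespace ErdosSimonovits

open SimpleGraph

/-! ### Adjacency indicators. -/

open Classical in
/-- The indicator of adjacency. -/
noncomputable def adjInd {V : Type*} (G : SimpleGraph V) (x y : V) : ℝ :=
  if G.Adj x y then 1 else 0

section adjInd

variable {V : Type*} (G : SimpleGraph V)

lemma adjInd_nonneg (x y : V) : 0 ≤ adjInd G x y := by
  unfold adjInd; split_ifs <;> norm_num

lemma adjInd_le_one (x y : V) : adjInd G x y ≤ 1 := by
  unfold adjInd; split_ifs <;> norm_num

lemma adjInd_comm (x y : V) : adjInd G x y = adjInd G y x := by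
  by_cases h : G.Adj x y <;> simp [adjInd, h, G.adj_comm y x]

open Classical in
lemma sum_adjInd_eq_degree [Fintype V] (x : V) : ∑ y, adjInd G x y = G.degree x := by
  simp only [adjInd, sum_boole, ← card_neighborFinset_eq_degree, neighborFinset_eq_filter]

open Classical in
lemma sum_sum_adjInd [Fintype V] : ∑ x, ∑ y, adjInd G x y = 2 * (G.edgeSet.ncard : ℝ) := by
  simp only [sum_adjInd_eq_degree]
  rw [← Nat.cast_sum, sum_degrees_eq_twice_card_edges, ← coe_edgeFinset, Set.ncard_coe_finset]
  push_cast; ring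

end adjInd

/-! ### Complete equipartite subgraphs as families of vertex sets. -/

/-- Disjointness of the parts need not be assumed: a common vertex would be adjacent to itself. The
free index type allows `Option (Fin r)`, that is, r parts and an extra one. -/
lemma completeEquipartiteGraph_isContained_of_parts {V ι : Type*} [Fintype ι] {G : SimpleGraph V}
    {r s : ℕ} (hι : Fintype.card ι = r) (P : ι → Finset V) (hP : ∀ a, s ≤ #(P a))
    (hadj : ∀ a b, a ≠ b → ∀ x ∈ P a, ∀ y ∈ P b, G.Adj x y) :
    completeEquipartiteGraph r s ⊑ G := by
  classical
  let e : Fin r ≃ ι := (Fintype.equivFinOfCardEq hι).symm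
  have h (a : ι) : Nonempty (Fin s ↪ P a) := by
    rw [Function.Embedding.nonempty_iff_card_le]; simpa using hP a
  let f := fun a => (h a).some
  refine ⟨⟨⟨fun p => (f (e p.1) p.2 : V), ?_⟩, ?_⟩⟩
  · rintro ⟨a, i⟩ ⟨b, j⟩ hab
    exact hadj _ _ (fun h => hab (e.injective h)) _ (f _ i).2 _ (f _ j).2
  · rintro ⟨a, i⟩ ⟨b, j⟩ hab
    change (f (e a) i : V) = f (e b) j at hab
    by_cases h : a = b
    · subst h
      rw [(f (e a)).injective (Subtype.ext hab)]
    · have := hadj _ _ (fun h' => h (e.injective h')) _ (f (e a) i).2 _ (f (e b) j).2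
      rw [hab] at this
      exact absurd this (G.irrefl)

lemma exists_parts_of_completeEquipartiteGraph_isContained {V : Type*} {G : SimpleGraph V}
    {r s : ℕ} (h : completeEquipartiteGraph r s ⊑ G) :
    ∃ P : Fin r → Finset V, (∀ a, #(P a) = s) ∧
      ∀ a b, a ≠ b → ∀ x ∈ P a, ∀ y ∈ P b, G.Adj x y := by
  classical
  obtain ⟨f⟩ := h
  refine ⟨fun a => univ.map ⟨fun i => f (a, i), fun i j hij => by
    simpa using f.injective hij⟩, fun a => by simp, ?_⟩
  intro a b hab x hx y hy
  simp only [Finset.mem_map, mem_univ, true_and] at hx hy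
  obtain ⟨i, rfl⟩ := hx
  obtain ⟨j, rfl⟩ := hy
  exact f.toHom.map_adj (by simpa using hab)

open Classical in
-- The Erdős–Stone theorem, from its minimum degree form.
/-- If minimum degree `d` forces a copy of `H` on `n + 1` vertices, then the extremal number of `H`
grows by less than `d` from `n` to `n + 1`. -/
lemma extremalNumber_lt_add_of_minDegree {W : Type*} {H : SimpleGraph W} (hH : H ≠ ⊥) {n : ℕ}
    {d : ℝ} (h : ∀ G : SimpleGraph (Fin (n + 1)), d ≤ (G.minDegree : ℝ) → H ⊑ G) :
    (extremalNumber (n + 1) H : ℝ) < extremalNumber n H + d := by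
  obtain ⟨G, inst, hG⟩ := exists_isExtremal_free (V := Fin (n + 1)) hH
  by_contra! hlt
  refine hG.prop (h G ?_)
  -- Deleting a vertex of minimum degree from an extremal graph leaves at most ex(n) edges, so the
  -- minimum degree is at least ex(n + 1) - ex(n), hence at least `d`.
  obtain ⟨v, hv⟩ := G.exists_minimal_degree_vertex
  have h1 := card_edgeFinset_deleteIncidenceSet_le_extremalNumber hG.prop v
  have h2 := card_edgeFinset_of_isExtremal_free hG
  have h3 := G.card_edgeFinset_deleteIncidenceSet v
  have h4 : G.degree v ≤ #G.edgeFinset := G.degree_le_card_edgeFinset v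
  simp only [Fintype.card_fin, Nat.add_sub_cancel] at h1 h2
  have h5 : extremalNumber (n + 1) H ≤ extremalNumber n H + G.degree v := by
    rw [← h2]
    have : #G.edgeFinset - G.degree v ≤ extremalNumber n H := by
      rw [← h3]; convert h1
    omega
  have h6 : (extremalNumber (n + 1) H : ℝ) ≤ extremalNumber n H + G.degree v := by
    exact_mod_cast h5
  have h7 : (G.minDegree : ℝ) = G.degree v := by
    rw [← hv]
  have h8 : d ≤ (G.degree v : ℝ) := by linarith
  rw [← h7] at h8
  convert h8

/-- **Erdős–Stone theorem**, in terms of the number of edges. -/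
lemma erdosStone (r t : ℕ) {ε : ℝ} (hε : 0 < ε) : ∃ N : ℕ, ∀ (V : Type u) [Fintype V]
    (G : SimpleGraph V), N ≤ Fintype.card V → ¬ completeEquipartiteGraph (r + 1) t ⊑ G →
    ∑ x, ∑ y, adjInd G x y ≤ (1 - 1 / (r : ℝ) + ε) * (Fintype.card V : ℝ) ^ 2 := by
  classical
  -- Without edges, containment is only a matter of having enough vertices.
  by_cases hH : completeEquipartiteGraph (r + 1) t = ⊥
  · refine ⟨(r + 1) * t, fun V _ G hn hG => absurd ?_ hG⟩
    rw [hH, bot_isContained_iff_card_le]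
    simpa using hn
  set c : ℝ := 1 - 1 / (r : ℝ) with hc
  have hc0 : 0 ≤ c := by
    rcases r with _ | r
    · simp [hc]
    · rw [hc, sub_nonneg, div_le_one (by positivity)]; push_cast; linarith [r.cast_nonneg (α := ℝ)]
  obtain ⟨N₀, hN₀⟩ := Filter.eventually_atTop.mp
    (eventually_completeEquipartiteGraph_isContained_of_minDegree (half_pos hε) r t)
  set a : ℕ → ℝ := fun n => extremalNumber n (completeEquipartiteGraph (r + 1) t) with ha
  have hstep (n : ℕ) (hn : N₀ ≤ n) : a (n + 1) ≤ a n + (c + ε / 2) * (n + 1) := by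
    refine (extremalNumber_lt_add_of_minDegree hH fun G hG => ?_).le
    refine hN₀ (n + 1) (by omega) ?_
    push_cast
    exact hG
  have hbd (k : ℕ) : a (N₀ + k) ≤ a N₀ + (c + ε / 2) * ((N₀ + k : ℝ) * (N₀ + k + 1) / 2) := by
    induction k with
    | zero => simp; positivity
    | succ k ih =>
      have := hstep (N₀ + k) (by omega)
      push_cast at this ⊢
      rw [← add_assoc]
      nlinarith
  -- Summing the increments gives a main term (c + ε/2)n²; from `M` on, the remaining ε/2 · n²
  -- absorbs the initial value 2 · ex(N₀) and the linear term.
  obtain ⟨M, hM⟩ := exists_nat_gt ((2 * a N₀ + (c + ε / 2)) / (ε / 2))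
  refine ⟨max (max N₀ M) 1, fun V _ G hn hG => ?_⟩
  simp only [max_le_iff] at hn
  obtain ⟨k, hk⟩ := Nat.exists_eq_add_of_le hn.1.1
  set n := Fintype.card V with hndef
  have h1 : (G.edgeSet.ncard : ℝ) ≤ a n := by
    simp only [ha]
    rw [← coe_edgeFinset, Set.ncard_coe_finset]
    exact_mod_cast card_edgeFinset_le_extremalNumber hG
  have h2 := hbd k
  rw [← hk] at h2
  have h3 : (N₀ : ℝ) + k = n := by rw [hk]; push_cast; ring
  rw [h3] at h2
  rw [sum_sum_adjInd]
  have h4 : (M : ℝ) ≤ n := by exact_mod_cast hn.1.2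
  have h5 : (1 : ℝ) ≤ n := by exact_mod_cast hn.2
  rw [div_lt_iff₀ (by positivity)] at hM
  have h6 : 2 * a N₀ + (c + ε / 2) ≤ n * (ε / 2) := by nlinarith
  have h7 : 0 ≤ a N₀ := by simp [ha]
  nlinarith

/-! ### Few low-degree vertices, and multipartite subgraphs avoiding them. -/

/-- Every pair not in `Lᶜ × Lᶜ` lies in a row or a column indexed by `L`, and by symmetry the two
contribute equally. -/
lemma sum_sum_le_add_sum_compl {V : Type*} [Fintype V] [DecidableEq V] (f : V → V → ℝ)
    (hf : ∀ x y, 0 ≤ f x y) (hsymm : ∀ x y, f x y = f y x) (L : Finset V) :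
    ∑ x, ∑ y, f x y ≤ ∑ x ∈ Lᶜ, ∑ y ∈ Lᶜ, f x y + 2 * ∑ x ∈ L, ∑ y, f x y := by
  have h1 : ∑ x, ∑ y, f x y = ∑ x ∈ L, ∑ y, f x y + ∑ x ∈ Lᶜ, ∑ y, f x y :=
    (sum_add_sum_compl L _).symm
  have h2 : ∑ x ∈ Lᶜ, ∑ y, f x y = ∑ x ∈ Lᶜ, ∑ y ∈ L, f x y + ∑ x ∈ Lᶜ, ∑ y ∈ Lᶜ, f x y := by
    rw [← sum_add_distrib]
    exact sum_congr rfl fun x _ => (sum_add_sum_compl L _).symm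
  have h3 : ∑ x ∈ Lᶜ, ∑ y ∈ L, f x y ≤ ∑ x, ∑ y ∈ L, f x y :=
    sum_le_sum_of_subset_of_nonneg (subset_univ _) fun x _ _ => sum_nonneg fun y _ => hf x y
  have h4 : ∑ x, ∑ y ∈ L, f x y = ∑ x ∈ L, ∑ y, f x y := by
    rw [sum_comm]
    exact sum_congr rfl fun x _ => sum_congr rfl fun y _ => hsymm y x
  linarith

/-- The terms 2qkn cancel. Removing k ≈ ηn low-degree vertices then gains k(2ηn - k) ≈ η²n², while
the two density errors cost at most η²n²/2. -/
lemma low_degree_arith {q η n k : ℝ} (hq1 : q ≤ 1) (hk0 : 0 ≤ k) (hkn : k ≤ n)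
    (hk1 : η * n ≤ k) (hk2 : k ≤ η * n + 1) (hn : 2 < n * η)
    (h : (q - η ^ 2 / 4) * n ^ 2 ≤ (q + η ^ 2 / 4) * (n - k) ^ 2 + 2 * (k * ((q - η) * n))) :
    False := by
  have e1 : (n - k) ^ 2 ≤ n ^ 2 := pow_le_pow_left₀ (by linarith) (by linarith) 2
  have e2 : η ^ 2 / 4 * (n - k) ^ 2 ≤ η ^ 2 / 4 * n ^ 2 :=
    mul_le_mul_of_nonneg_left e1 (by positivity)
  have e3 : q * k ^ 2 ≤ 1 * k ^ 2 := mul_le_mul_of_nonneg_right hq1 (sq_nonneg k)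
  have e4 : k * k ≤ k * (η * n + 1) := mul_le_mul_of_nonneg_left hk2 hk0
  have e5 : η * n * (η * n - 1) ≤ k * (η * n - 1) :=
    mul_le_mul_of_nonneg_right hk1 (by linarith)
  have e6 : k * (η * n - 1) ≤ (n * η) ^ 2 / 2 := by linarith
  have e7 : 0 < (n * η) * (n * η - 2) := mul_pos (by linarith) (by linarith)
  linarith

/-- In a dense graph without a large complete `(r + 1)`-partite subgraph, few vertices have a
degree well below the average. -/
lemma exists_card_low_degree_le {r s : ℕ} (hr : 1 ≤ r) {η : ℝ} (hη : 0 < η) (hη' : η ≤ 1 / 2) :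
    ∃ ε' : ℝ, 0 < ε' ∧ ∃ N : ℕ, ∀ (V : Type u) [Fintype V] (G : SimpleGraph V),
      N ≤ Fintype.card V → ¬ completeEquipartiteGraph (r + 1) s ⊑ G →
      (1 - 1 / (r : ℝ) - ε') * (Fintype.card V : ℝ) ^ 2 ≤ ∑ x, ∑ y, adjInd G x y →
      (#{v | ∑ y, adjInd G v y < (1 - 1 / (r : ℝ) - η) * Fintype.card V} : ℝ)
        ≤ η * Fintype.card V := by
  classical
  obtain ⟨N, hN⟩ := erdosStone.{u} r s (ε := η ^ 2 / 4) (by positivity)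
  obtain ⟨M, hM⟩ := exists_nat_gt (2 / η)
  refine ⟨η ^ 2 / 4, by positivity, max M (2 * N + 2), fun V _ G hn hG hdens => ?_⟩
  simp only [max_le_iff] at hn
  set n := Fintype.card V with hndef
  set q : ℝ := 1 - 1 / (r : ℝ) with hq
  have hr' : (1 : ℝ) ≤ r := by exact_mod_cast hr
  have hq1 : q ≤ 1 := by rw [hq]; have : 0 < 1 / (r : ℝ) := by positivity
                         linarith
  by_contra! hlow
  have hnM : (2 / η : ℝ) < n := hM.trans_le (by exact_mod_cast hn.1)
  rw [div_lt_iff₀ hη] at hnM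
  have hnN : 2 * (N : ℝ) + 2 ≤ n := by exact_mod_cast hn.2
  obtain ⟨L, hL, hLk⟩ := exists_subset_card_eq (Nat.ceil_le.mpr hlow.le)
  set k := #L with hk
  have hk1 : η * n ≤ k := by rw [hLk]; exact Nat.le_ceil _
  have hk2 : (k : ℝ) < η * n + 1 := by rw [hLk]; exact Nat.ceil_lt_add_one (by positivity)
  have hkn : k ≤ n := card_le_univ L
  have hsub : Fintype.card {x // x ∈ Lᶜ} = n - k := by
    rw [Fintype.card_coe, card_compl]
  have hcast : ((n - k : ℕ) : ℝ) = n - k := by push_cast [hkn]; ring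
  have hcard : N ≤ Fintype.card {x // x ∈ Lᶜ} := by
    rw [hsub, ← Nat.cast_le (α := ℝ), hcast]
    nlinarith
  have hup := hN {x // x ∈ Lᶜ} (G.comap Subtype.val) hcard
    (fun h => hG (h.trans ⟨(Embedding.comap (Function.Embedding.subtype _) G).toCopy⟩))
  have hsum : ∑ x : {x // x ∈ Lᶜ}, ∑ y : {x // x ∈ Lᶜ}, adjInd (G.comap Subtype.val) x y
      = ∑ x ∈ Lᶜ, ∑ y ∈ Lᶜ, adjInd G x y := by
    rw [← sum_coe_sort Lᶜ]
    refine sum_congr rfl fun x _ => ?_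
    rw [← sum_coe_sort Lᶜ]
    rfl
  rw [hsum, hsub, hcast] at hup
  have hdec := sum_sum_le_add_sum_compl (adjInd G) (adjInd_nonneg G) (adjInd_comm G) L
  have hLs : ∑ x ∈ L, ∑ y, adjInd G x y ≤ k * ((q - η) * n) := by
    rw [hk, ← nsmul_eq_mul]
    refine sum_le_card_nsmul _ _ _ fun x hx => ?_
    have := hL hx
    simp only [mem_filter, mem_univ, true_and] at this
    exact this.le
  have hk0 : (0 : ℝ) ≤ k := Nat.cast_nonneg _
  have hkn' : (k : ℝ) ≤ n := by exact_mod_cast hkn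
  refine low_degree_arith hq1 hk0 hkn' hk1 hk2.le hnM (hdens.trans (hdec.trans ?_))
  linarith

/-- A graph of density above `1 - 1 / r` contains large complete `(r + 1)`-partite subgraphs
avoiding a prescribed small set of vertices. -/
lemma exists_parts_disjoint {r t : ℕ} (hr : 1 ≤ r) (ht : 1 ≤ t) {η : ℝ}
    (hη : 3 * η < 1 / (r : ℝ) - 1 / (r + 1 : ℝ)) :
    ∃ N : ℕ, ∀ (V : Type u) [Fintype V] (G : SimpleGraph V) (L : Finset V),
      N ≤ Fintype.card V → (#L : ℝ) ≤ η * Fintype.card V →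
      (1 - 1 / (r + 1 : ℝ) - η) * (Fintype.card V : ℝ) ^ 2 ≤ ∑ x, ∑ y, adjInd G x y →
      ∃ P : Fin (r + 1) → Finset V, (∀ a, #(P a) = t) ∧
        (∀ a b, a ≠ b → ∀ x ∈ P a, ∀ y ∈ P b, G.Adj x y) ∧ ∀ a, ∀ x ∈ P a, x ∉ L := by
  classical
  obtain ⟨N, hN⟩ := erdosStone.{u} r t
    (ε := (1 / (r : ℝ) - 1 / (r + 1 : ℝ) - 3 * η) / 2) (by linarith)
  refine ⟨max N 1, fun V _ G L hn hL hdens => ?_⟩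
  simp only [max_le_iff] at hn
  set n := Fintype.card V with hndef
  have hn1 : (1 : ℝ) ≤ n := by exact_mod_cast hn.2
  -- The edges at `L` are removed but its vertices stay, isolated. Each vertex of a K_{r+1}(t) with
  -- r, t ≥ 1 has a neighbour, so a copy in `G'` avoids `L`. The removal costs at most 2ηn², whence
  -- the 3η in the hypothesis.
  let G' : SimpleGraph V :=
    { Adj := fun x y => G.Adj x y ∧ x ∉ L ∧ y ∉ L
      symm := ⟨fun x y h => ⟨h.1.symm, h.2.2, h.2.1⟩⟩
      loopless := ⟨fun x h => G.irrefl h.1⟩ }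
  by_cases hG' : completeEquipartiteGraph (r + 1) t ⊑ G'
  · obtain ⟨P, hP, hadj⟩ := exists_parts_of_completeEquipartiteGraph_isContained hG'
    refine ⟨P, hP, fun a b hab x hx y hy => (hadj a b hab x hx y hy).1, fun a x hx => ?_⟩
    have : Nontrivial (Fin (r + 1)) := Fin.nontrivial_iff_two_le.mpr (by omega)
    obtain ⟨b, hb⟩ := exists_ne a
    obtain ⟨y, hy⟩ : (P b).Nonempty := by rw [← card_pos, hP]; exact ht
    exact (hadj a b hb.symm x hx y hy).2.1
  · have hup := hN V G' hn.1 hG'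
    have hdec := sum_sum_le_add_sum_compl (adjInd G) (adjInd_nonneg G) (adjInd_comm G) L
    have h1 : ∑ x ∈ Lᶜ, ∑ y ∈ Lᶜ, adjInd G x y ≤ ∑ x, ∑ y, adjInd G' x y := by
      calc _ = ∑ x ∈ Lᶜ, ∑ y ∈ Lᶜ, adjInd G' x y := by
            refine sum_congr rfl fun x hx => sum_congr rfl fun y hy => ?_
            rw [mem_compl] at hx hy
            simp [adjInd, G', hx, hy]
        _ ≤ ∑ x ∈ Lᶜ, ∑ y, adjInd G' x y := sum_le_sum fun x _ =>
            sum_le_sum_of_subset_of_nonneg (subset_univ _) fun y _ _ => adjInd_nonneg _ _ _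
        _ ≤ _ := sum_le_sum_of_subset_of_nonneg (subset_univ _) fun y _ _ =>
            sum_nonneg fun _ _ => adjInd_nonneg _ _ _
    have h2 : ∑ x ∈ L, ∑ y, adjInd G x y ≤ #L * n := by
      rw [← nsmul_eq_mul]
      refine sum_le_card_nsmul _ _ _ fun x hx => ?_
      calc ∑ y, adjInd G x y ≤ ∑ y : V, (1 : ℝ) := sum_le_sum fun y _ => adjInd_le_one G x y
        _ = n := by simp [hndef]
    have h3 : (#L : ℝ) * n ≤ η * n ^ 2 := by nlinarith
    have h4 : 0 < (1 / (r : ℝ) - 1 / (r + 1 : ℝ) - 3 * η) / 2 * (n : ℝ) ^ 2 :=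
      mul_pos (by linarith) (by positivity)
    exfalso
    nlinarith

/-! ### Colouring the vertices by a complete r-partite subgraph. -/

open Classical in
/-- Few vertices have many neighbours in every part of a complete `r`-partite subgraph. -/
lemma card_rich_le {V : Type*} [Fintype V] {G : SimpleGraph V} {r s t : ℕ}
    (hG : ¬ completeEquipartiteGraph (r + 1) s ⊑ G) (P : Fin r → Finset V) (hP : ∀ a, #(P a) = t)
    (hadj : ∀ a b, a ≠ b → ∀ x ∈ P a, ∀ y ∈ P b, G.Adj x y) :
    #{v | ∀ a, s ≤ #{x ∈ P a | G.Adj v x}} ≤ t.choose s ^ r * s := by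
  by_contra! hlt
  have hex (v : V) : ∃ S : Fin r → Finset V, v ∈ ({v | ∀ a, s ≤ #{x ∈ P a | G.Adj v x}} : Finset V)
      → ∀ a, S a ⊆ {x ∈ P a | G.Adj v x} ∧ #(S a) = s := by
    by_cases hv : v ∈ ({v | ∀ a, s ≤ #{x ∈ P a | G.Adj v x}} : Finset V)
    · have hv' := hv
      simp only [mem_filter, mem_univ, true_and] at hv'
      choose S hS using fun a => exists_subset_card_eq (hv' a)
      exact ⟨S, fun _ => hS⟩
    · exact ⟨fun _ => ∅, fun h => absurd h hv⟩
  choose S hS using hex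
  -- Each rich vertex selects `s` neighbours in every part. By pigeonhole more than `s` of them make
  -- the same selection `y`, and these form the extra part of a K_{r+1}(s).
  obtain ⟨y, hy, hcard⟩ := exists_lt_card_fiber_of_mul_lt_card_of_maps_to
    (s := ({v | ∀ a, s ≤ #{x ∈ P a | G.Adj v x}} : Finset V))
    (t := Fintype.piFinset fun a => (P a).powersetCard s) (f := S) (n := s)
    (fun v hv => by
      rw [Fintype.mem_piFinset]
      intro a
      rw [mem_powersetCard]
      exact ⟨(hS v hv a).1.trans (filter_subset _ _), (hS v hv a).2⟩)
    (by simpa [Fintype.card_piFinset, hP] using hlt)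
  rw [Fintype.mem_piFinset] at hy
  simp only [mem_powersetCard] at hy
  refine hG (completeEquipartiteGraph_isContained_of_parts (ι := Option (Fin r)) (by simp)
    (fun o => o.elim {v ∈ ({v | ∀ a, s ≤ #{x ∈ P a | G.Adj v x}} : Finset V) | S v = y} y) ?_ ?_)
  · rintro (_ | a)
    · exact hcard.le
    · exact (hy a).2.ge
  · have key (a : Fin r) (v : V)
        (hv : v ∈ {v ∈ ({v | ∀ a, s ≤ #{x ∈ P a | G.Adj v x}} : Finset V) | S v = y})
        (x : V) (hx : x ∈ y a) : G.Adj v x := by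
      obtain ⟨hv', rfl⟩ := mem_filter.mp hv
      exact (mem_filter.mp ((hS v hv' a).1 hx)).2
    rintro (_ | a) (_ | b) hab x hx z hz
    · exact absurd rfl hab
    · exact key b x hx z hz
    · exact (key a z hz x hx).symm
    · exact hadj a b (by simpa using hab) x ((hy a).1 hx) z ((hy b).1 hz)

open Classical in
/-- If all vertices miss at most a `1 / (4 * s)`-fraction of the parts of a complete `r`-partite
subgraph other than that of their own colour, then the colour classes are sparse. -/
lemma not_completeBipartite_isContained {V : Type*} [Fintype V] {G : SimpleGraph V} {r s t : ℕ}
    (hG : ¬ completeEquipartiteGraph (r + 1) s ⊑ G) (hs : 1 ≤ s) (hst : 2 * s ≤ t)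
    (P : Fin r → Finset V) (hP : ∀ a, #(P a) = t)
    (hadj : ∀ a b, a ≠ b → ∀ x ∈ P a, ∀ y ∈ P b, G.Adj x y) (c : V → Fin r)
    (G' : SimpleGraph V) (hG' : ∀ x y, G'.Adj x y → G.Adj x y ∧ c x = c y ∧
      ∀ b, b ≠ c x → #{z ∈ P b | ¬ G.Adj x z} * (4 * s) ≤ t) :
    ¬ completeEquipartiteGraph 2 s ⊑ G' := by
  intro hcon
  obtain ⟨A, hA, hAadj⟩ := exists_parts_of_completeEquipartiteGraph_isContained hcon
  have h01 := hAadj 0 1 (by simp)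
  obtain ⟨x₀, hx₀⟩ : (A 0).Nonempty := by rw [← card_pos, hA]; exact hs
  obtain ⟨y₀, hy₀⟩ : (A 1).Nonempty := by rw [← card_pos, hA]; exact hs
  set a := c x₀ with ha
  have hc1 (y) (hy : y ∈ A 1) : c y = a := (hG' _ _ (h01 _ hx₀ _ hy)).2.1.symm
  have hc0 (x) (hx : x ∈ A 0) : c x = a := by
    rw [(hG' _ _ (h01 _ hx _ hy₀)).2.1, hc1 _ hy₀]
  have hmiss (v) (hv : v ∈ A 0 ∪ A 1) (b) (hb : b ≠ a) :
      #{z ∈ P b | ¬ G.Adj v z} * (4 * s) ≤ t := by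
    rcases mem_union.mp hv with hv | hv
    · exact (hG' _ _ (h01 _ hv _ hy₀)).2.2 b (by rwa [hc0 _ hv])
    · exact (hG' _ _ (h01 _ hx₀ _ hv).symm).2.2 b (by rwa [hc1 _ hv])
  -- The two sides `A 0` and `A 1` replace part `a`. In any other part these 2s vertices together
  -- miss at most 2s · t/(4s) = t/2 vertices, leaving t/2 ≥ s common neighbours.
  refine hG (completeEquipartiteGraph_isContained_of_parts (ι := Option (Fin r)) (by simp)
    (fun o => o.elim (A 0) fun b => if b = a then A 1 else
      {z ∈ P b | ∀ v ∈ A 0 ∪ A 1, G.Adj v z}) ?_ ?_)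
  · rintro (_ | b)
    · exact (hA 0).ge
    · by_cases hb : b = a
      · simp [hb, hA]
      · simp only [Option.elim_some, hb, if_false]
        have h1 : P b ⊆ {z ∈ P b | ∀ v ∈ A 0 ∪ A 1, G.Adj v z} ∪
            (A 0 ∪ A 1).biUnion fun v => {z ∈ P b | ¬ G.Adj v z} := by
          intro z hz
          by_cases h : ∀ v ∈ A 0 ∪ A 1, G.Adj v z
          · exact mem_union_left _ (mem_filter.mpr ⟨hz, h⟩)
          · push Not at h
            obtain ⟨v, hv, hvz⟩ := h
            exact mem_union_right _ (mem_biUnion.mpr ⟨v, hv, mem_filter.mpr ⟨hz, hvz⟩⟩)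
        have h2 := (card_le_card h1).trans (card_union_le _ _)
        rw [hP] at h2
        have h3 : #((A 0 ∪ A 1).biUnion fun v => {z ∈ P b | ¬ G.Adj v z}) * (4 * s)
            ≤ (2 * s) * t := by
          calc _ ≤ (∑ v ∈ A 0 ∪ A 1, #{z ∈ P b | ¬ G.Adj v z}) * (4 * s) :=
                Nat.mul_le_mul_right _ card_biUnion_le
            _ = ∑ v ∈ A 0 ∪ A 1, #{z ∈ P b | ¬ G.Adj v z} * (4 * s) := sum_mul _ _ _
            _ ≤ #(A 0 ∪ A 1) * t := by
                rw [← smul_eq_mul]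
                exact sum_le_card_nsmul _ _ _ fun v hv => hmiss v hv b hb
            _ ≤ _ := by
                refine Nat.mul_le_mul_right _ ((card_union_le _ _).trans ?_)
                rw [hA, hA]; omega
        have h4 : #((A 0 ∪ A 1).biUnion fun v => {z ∈ P b | ¬ G.Adj v z}) * 2 ≤ t := by
          refine Nat.le_of_mul_le_mul_left (c := 2 * s) ?_ (by omega)
          calc _ = #((A 0 ∪ A 1).biUnion fun v => {z ∈ P b | ¬ G.Adj v z}) * (4 * s) := by ring
            _ ≤ _ := h3
        omega
  · have key (b : Fin r) (x : V) (hx : x ∈ A 0) (y : V) (hy : y ∈ (if b = a then A 1 else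
        {z ∈ P b | ∀ v ∈ A 0 ∪ A 1, G.Adj v z})) : G.Adj x y := by
      split_ifs at hy with hb
      · exact (hG' _ _ (h01 _ hx _ hy)).1
      · exact (mem_filter.mp hy).2 x (mem_union_left _ hx)
    rintro (_ | b) (_ | b') hbb x hx y hy
    · exact absurd rfl hbb
    · exact key b' x hx y hy
    · exact (key b y hy x hx).symm
    · have hbb' : b ≠ b' := by simpa using hbb
      simp only [Option.elim_some] at hx hy
      split_ifs at hx hy with h1 h2 h2
      · exact absurd (h1.trans h2.symm) hbb'
      · exact (mem_filter.mp hy).2 x (mem_union_right _ hx)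
      · exact ((mem_filter.mp hx).2 y (mem_union_right _ hy)).symm
      · exact hadj b b' hbb' x (mem_filter.mp hx).1 y (mem_filter.mp hy).1

open Classical in
/-- A complete `r`-partite subgraph on vertices of large degree induces a colouring of almost all
vertices whose colour classes contain no large complete bipartite graph. -/
lemma exists_coloring_of_parts {V : Type*} [Fintype V] {G : SimpleGraph V} {r s t : ℕ} {η : ℝ}
    (hr : 1 ≤ r) (hG : ¬ completeEquipartiteGraph (r + 1) s ⊑ G) (hs : 1 ≤ s) (hst : 2 * s ≤ t)
    (P : Fin r → Finset V) (hP : ∀ a, #(P a) = t)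
    (hadj : ∀ a b, a ≠ b → ∀ x ∈ P a, ∀ y ∈ P b, G.Adj x y)
    (hdeg : ∀ a, ∀ x ∈ P a, (1 - 1 / (r : ℝ) - η) * Fintype.card V ≤ ∑ y, adjInd G x y) :
    ∃ (c : V → Fin r) (B : Finset V) (G' : SimpleGraph V),
      (t / (4 * s) : ℝ) * #B ≤ Fintype.card V * s + 2 * (t.choose s ^ r * s : ℕ) * t
        + r * η * t * Fintype.card V ∧
      (∀ x y, G.Adj x y → c x = c y → x ∉ B → y ∉ B → G'.Adj x y) ∧
      ¬ completeEquipartiteGraph 2 s ⊑ G' := by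
  set n := Fintype.card V with hn
  set d : V → Fin r → ℕ := fun v a => #{x ∈ P a | G.Adj v x} with hd
  set R : Finset V := {v | ∀ a, s ≤ d v a} with hR
  have hRcard : #R ≤ t.choose s ^ r * s := card_rich_le hG P hP hadj
  have hc (v : V) : ∃ a : Fin r, v ∉ R → d v a < s := by
    by_cases hv : v ∈ R
    · exact ⟨⟨0, hr⟩, fun h => absurd hv h⟩
    · have hv' := hv
      simp only [hR, mem_filter, mem_univ, true_and, not_forall, not_le] at hv'
      obtain ⟨a, ha⟩ := hv'
      exact ⟨a, fun _ => ha⟩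
  choose c hc using hc
  set good : V → Prop := fun v => ∀ b, b ≠ c v → #{z ∈ P b | ¬ G.Adj v z} * (4 * s) ≤ t with hgood
  set B₀ : Finset V := {v | v ∉ R ∧ ¬ good v} with hB₀
  have hsplit (v a) : d v a + #{z ∈ P a | ¬ G.Adj v z} = t := by
    rw [← hP a]; exact card_filter_add_card_filter_not _
  have hs0 : (0 : ℝ) < s := by exact_mod_cast hs
  have ht0 : (0 : ℝ) < t := by
    have : 0 < t := by omega
    exact_mod_cast this
  have hds (v a) : (d v a : ℝ) ≤ t := by
    have := hsplit v a
    exact_mod_cast (by omega : d v a ≤ t)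
  -- A vertex outside `R` has at most `s` neighbours in its own part and `t` in each other part; one
  -- in `B₀` loses a further t/(4s). Summation over `v` is then compared with the degree bound
  -- `hlow`.
  have hsumd (v : V) : (∑ a, (d v a : ℝ)) ≤ (r - 1) * t + s + (if v ∈ R then (t : ℝ) else 0)
      - (if v ∈ B₀ then (t / (4 * s) : ℝ) else 0) := by
    by_cases hv : v ∈ R
    · have hvB : v ∉ B₀ := by simp [hB₀, hv]
      simp only [hv, hvB, if_true, if_false]
      have : (∑ a, (d v a : ℝ)) ≤ ∑ a : Fin r, (t : ℝ) := sum_le_sum fun a _ => hds v a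
      simp only [sum_const, card_univ, Fintype.card_fin, nsmul_eq_mul] at this
      linarith
    · have h1 : (d v (c v) : ℝ) ≤ s := by exact_mod_cast (hc v hv).le
      rw [← add_sum_erase univ _ (mem_univ (c v))]
      have hcard : (#(univ.erase (c v)) : ℝ) = r - 1 := by
        rw [card_erase_of_mem (mem_univ _), card_univ, Fintype.card_fin]
        push_cast [hr]; ring
      by_cases hvB : v ∈ B₀
      · simp only [hv, hvB, if_true, if_false]
        have hng : ¬ good v := (mem_filter.mp hvB).2.2
        simp only [hgood, not_forall, not_le] at hng
        obtain ⟨b, hb, hlt⟩ := hng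
        have hbm : b ∈ univ.erase (c v) := by simp [hb]
        rw [← add_sum_erase _ _ hbm]
        have h2 : (∑ a ∈ (univ.erase (c v)).erase b, (d v a : ℝ)) ≤ (r - 2) * t := by
          have h3 : (#((univ.erase (c v)).erase b) : ℝ) = r - 2 := by
            rw [card_erase_of_mem hbm, Nat.cast_pred (card_pos.mpr ⟨b, hbm⟩), hcard]; ring
          rw [← h3, ← nsmul_eq_mul]
          exact sum_le_card_nsmul _ _ _ fun a _ => hds v a
        have h4 : (t / (4 * s) : ℝ) ≤ #{z ∈ P b | ¬ G.Adj v z} := by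
          rw [div_le_iff₀ (by positivity)]
          exact_mod_cast hlt.le
        have h5 : (d v b : ℝ) + #{z ∈ P b | ¬ G.Adj v z} = t := by exact_mod_cast hsplit v b
        linarith
      · simp only [hv, hvB, if_false]
        have h2 : (∑ a ∈ univ.erase (c v), (d v a : ℝ)) ≤ (r - 1) * t := by
          rw [← hcard, ← nsmul_eq_mul]
          exact sum_le_card_nsmul _ _ _ fun a _ => hds v a
        linarith
  have hlow : r * (t * ((1 - 1 / (r : ℝ) - η) * n)) ≤ ∑ v, ∑ a, (d v a : ℝ) := by
    have h1 (v a) : (d v a : ℝ) = ∑ x ∈ P a, adjInd G x v := by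
      simp only [hd, adjInd, sum_boole, G.adj_comm v]
    rw [sum_comm]
    have h2 (a : Fin r) : t * ((1 - 1 / (r : ℝ) - η) * n) ≤ ∑ v, (d v a : ℝ) := by
      simp only [h1]
      rw [sum_comm, ← hP a, ← nsmul_eq_mul]
      exact card_nsmul_le_sum _ _ _ fun x hx => hdeg a x hx
    calc _ = ∑ a : Fin r, t * ((1 - 1 / (r : ℝ) - η) * n) := by simp
      _ ≤ _ := sum_le_sum fun a _ => h2 a
  have hup := sum_le_sum fun v (_ : v ∈ univ) => hsumd v
  rw [sum_sub_distrib, sum_add_distrib] at hup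
  simp only [sum_const, card_univ, nsmul_eq_mul, sum_ite_mem, univ_inter, ← hn] at hup
  have hr0 : (r : ℝ) ≠ 0 := by positivity
  have hmul : r * (t * ((1 - 1 / (r : ℝ) - η) * n)) = (r - 1) * t * n - r * η * t * n := by
    field_simp
  have hRt : (#R : ℝ) * t ≤ (t.choose s ^ r * s : ℕ) * t :=
    mul_le_mul_of_nonneg_right (by exact_mod_cast hRcard) ht0.le
  -- Vertices of `R` have a meaningless colour and join the exceptional set; they enter the bound a
  -- second time, whence its factor 2.
  refine ⟨c, R ∪ B₀,
    { Adj := fun x y => G.Adj x y ∧ c x = c y ∧ good x ∧ good y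
      symm := ⟨fun x y h => ⟨h.1.symm, h.2.1.symm, h.2.2.2, h.2.2.1⟩⟩
      loopless := ⟨fun x h => G.irrefl h.1⟩ }, ?_, ?_, ?_⟩
  · have h1 : (#(R ∪ B₀) : ℝ) ≤ #R + #B₀ := by exact_mod_cast card_union_le _ _
    have h2 : (t / (4 * s) : ℝ) * #(R ∪ B₀) ≤ t / (4 * s) * (#R + #B₀) :=
      mul_le_mul_of_nonneg_left h1 (by positivity)
    have h3 : (t / (4 * s) : ℝ) * #R ≤ t * #R := by
      refine mul_le_mul_of_nonneg_right ?_ (Nat.cast_nonneg _)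
      apply div_le_self ht0.le
      have : (1 : ℝ) ≤ s := by exact_mod_cast hs
      linarith
    linarith
  · intro x y hxy hcxy hx hy
    simp only [hB₀, mem_union, mem_filter, mem_univ, true_and, not_or, not_and, not_not] at hx hy
    exact ⟨hxy, hcxy, hx.2 hx.1, hy.2 hy.1⟩
  · exact not_completeBipartite_isContained hG hs hst P hP hadj c _
      fun x y h => ⟨h.1, h.2.1, h.2.2.1⟩

open Classical in
/-- A dense graph without a large complete `(r + 1)`-partite subgraph has an `r`-colouring with few
monochromatic edges. -/
lemma exists_coloring {r s : ℕ} (hr : 1 ≤ r) (hs : 1 ≤ s) {κ : ℝ} (hκ : 0 < κ) :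
    ∃ ε' : ℝ, 0 < ε' ∧ ∃ N : ℕ, ∀ (V : Type u) [Fintype V] (G : SimpleGraph V),
      N ≤ Fintype.card V → ¬ completeEquipartiteGraph (r + 1) s ⊑ G →
      (1 - 1 / (r : ℝ) - ε') * (Fintype.card V : ℝ) ^ 2 ≤ ∑ x, ∑ y, adjInd G x y →
      ∃ c : V → Fin r, ∑ x, ∑ y, (if c x = c y then adjInd G x y else 0)
        ≤ κ * (Fintype.card V : ℝ) ^ 2 := by
  -- For r = 1 all edges are monochromatic, and excluding K_2(s) already makes the graph sparse.
  obtain rfl | hr2 := hr.eq_or_lt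
  · obtain ⟨N, hN⟩ := erdosStone.{u} 1 s hκ
    refine ⟨1, one_pos, N, fun V _ G hn hG _ => ⟨fun _ => 0, ?_⟩⟩
    simpa using hN V G hn hG
  obtain ⟨r, rfl⟩ : ∃ k, r = k + 1 := ⟨r - 1, by omega⟩
  replace hr2 : 1 ≤ r := by omega
  have hs0 : (0 : ℝ) < s := by exact_mod_cast hs
  have hr0 : (0 : ℝ) < r := by exact_mod_cast hr2
  set gap : ℝ := 1 / (r : ℝ) - 1 / (r + 1 : ℝ) with hgap
  have hgap0 : 0 < gap := by
    rw [hgap, sub_pos]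
    exact one_div_lt_one_div_of_lt hr0 (by linarith)
  -- the proportion of vertices that stay uncoloured is at most `κ / 4`
  set η : ℝ := min (min (gap / 4) (1 / 2)) (κ / (64 * s * (r + 1))) with hη
  have hη0 : 0 < η := by rw [hη]; positivity
  have hη1 : η ≤ gap / 4 := (min_le_left _ _).trans (min_le_left _ _)
  have hη2 : η ≤ 1 / 2 := (min_le_left _ _).trans (min_le_right _ _)
  have hη3 : (r + 1) * η ≤ κ / (64 * s) := by
    have : η ≤ κ / (64 * s * (r + 1)) := min_le_right _ _
    rw [le_div_iff₀ (by positivity)] at this ⊢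
    linarith
  -- The bound on (t/(4s))|B| consists of four terms (the one in `C` counts twice), and `t`, `M` and
  -- `η` make each at most κ/(64s) · nt. This yields |B| ≤ κn/4.
  obtain ⟨t₀, ht₀⟩ := exists_nat_gt (64 * s * s / κ)
  set t := max t₀ (2 * s) with ht
  have hst : 2 * s ≤ t := le_max_right _ _
  have ht1 : (s : ℝ) ≤ κ / (64 * s) * t := by
    have h1 : (t₀ : ℝ) ≤ t := by exact_mod_cast le_max_left _ _
    rw [div_lt_iff₀ hκ] at ht₀
    rw [div_mul_eq_mul_div, le_div_iff₀ (by positivity)]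
    nlinarith
  have ht0 : (0 : ℝ) < t := by
    have : 0 < t := by omega
    exact_mod_cast this
  set C := t.choose s ^ (r + 1) * s with hC
  obtain ⟨M, hM⟩ := exists_nat_gt (64 * s * (C : ℝ) / κ)
  obtain ⟨ε₁, hε₁, N₁, hN₁⟩ := exists_card_low_degree_le.{u} (r := r + 1) (s := s) (by omega) hη0 hη2
  obtain ⟨N₂, hN₂⟩ := exists_parts_disjoint.{u} (r := r) (t := t) (η := η) hr2 (by omega)
    (by linarith)
  obtain ⟨N₃, hN₃⟩ := erdosStone.{u} 1 s (half_pos hκ)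
  refine ⟨min ε₁ η, lt_min hε₁ hη0, max (max N₁ N₂) (max N₃ M), fun V _ G hn hG hdens => ?_⟩
  simp only [max_le_iff] at hn
  set n := Fintype.card V with hndef
  have hn2 : (0 : ℝ) ≤ (n : ℝ) ^ 2 := by positivity
  set L : Finset V := {v | ∑ y, adjInd G v y < (1 - 1 / ((r + 1 : ℕ) : ℝ) - η) * n} with hL
  have hLcard : (#L : ℝ) ≤ η * n := by
    refine hN₁ V G hn.1.1 hG (le_trans ?_ hdens)
    refine mul_le_mul_of_nonneg_right ?_ hn2
    linarith [min_le_left ε₁ η]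
  obtain ⟨P, hP, hadj, hPL⟩ := hN₂ V G L hn.1.2 hLcard (by
    refine le_trans ?_ hdens
    refine mul_le_mul_of_nonneg_right ?_ hn2
    push_cast
    linarith [min_le_right ε₁ η])
  obtain ⟨c, B, G', hB, hG', hfree⟩ := exists_coloring_of_parts hr hG hs hst P hP hadj
    (η := η) fun a x hx => by
      have := hPL a x hx
      simpa only [hL, mem_filter, mem_univ, true_and, not_lt] using this
  refine ⟨c, ?_⟩
  have hMn : 64 * s * (C : ℝ) ≤ n * κ := by
    rw [div_lt_iff₀ hκ] at hM
    have : (M : ℝ) ≤ n := by exact_mod_cast hn.2.2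
    nlinarith
  have hCt : (C : ℝ) * t ≤ κ / (64 * s) * n * t := by
    refine mul_le_mul_of_nonneg_right ?_ ht0.le
    rw [div_mul_eq_mul_div, le_div_iff₀ (by positivity)]
    linarith
  have hst' : (n : ℝ) * s ≤ n * (κ / (64 * s) * t) :=
    mul_le_mul_of_nonneg_left ht1 (Nat.cast_nonneg _)
  have hηt : (r + 1) * η * (t * n) ≤ κ / (64 * s) * (t * n) :=
    mul_le_mul_of_nonneg_right hη3 (by positivity)
  have hB' : (#B : ℝ) ≤ κ / 4 * n := by
    have h1 : (t / (4 * s) : ℝ) * #B ≤ 4 * (κ / (64 * s) * n * t) := by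
      push_cast at hB
      have : ((t.choose s : ℝ) ^ (r + 1) * s) = C := by rw [hC]; push_cast; ring
      rw [this] at hB
      linarith
    have h2 : (t / (4 * s) : ℝ) * (κ / 4 * n) = 4 * (κ / (64 * s) * n * t) := by
      field_simp; ring
    rw [← h2] at h1
    exact le_of_mul_le_mul_left h1 (by positivity)
  have hsparse := hN₃ V G' hn.2.1 hfree
  have hpt (x y : V) : (if c x = c y then adjInd G x y else 0)
      ≤ adjInd G' x y + ((if x ∈ B then (1 : ℝ) else 0) + if y ∈ B then (1 : ℝ) else 0) := by
    have h0 := adjInd_nonneg G' x y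
    have h1 := adjInd_le_one G x y
    by_cases hcxy : c x = c y
    · rw [if_pos hcxy]
      by_cases hx : x ∈ B
      · simp only [hx, if_true]; split_ifs <;> linarith
      · by_cases hy : y ∈ B
        · simp only [hx, hy, if_true, if_false]; linarith
        · simp only [hx, hy, if_false, add_zero]
          by_cases hxy : G.Adj x y
          · simp [adjInd, hxy, hG' x y hxy hcxy hx hy]
          · simpa [adjInd, hxy] using h0
    · rw [if_neg hcxy]; positivity
  calc _ ≤ ∑ x, ∑ y, (adjInd G' x y +
        ((if x ∈ B then (1 : ℝ) else 0) + if y ∈ B then (1 : ℝ) else 0)) :=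
        sum_le_sum fun x _ => sum_le_sum fun y _ => hpt x y
    _ = ∑ x, ∑ y, adjInd G' x y + 2 * (n * #B) := by
        simp only [sum_add_distrib, sum_const, card_univ, sum_ite_mem, univ_inter,
          nsmul_eq_mul, ← hndef, ← mul_sum]
        ring
    _ ≤ κ / 2 * n ^ 2 + 2 * (n * (κ / 4 * n)) := by
        refine add_le_add ?_ (by gcongr)
        simpa using hsparse
    _ = κ * n ^ 2 := by ring

/-! ### From a colouring to the Turán graph. -/

/-- Two colourings of sets of the same size can be aligned up to the differences of the sizes of
their colour classes. -/
lemma exists_equiv_card_ne_le {V W κ : Type*} [Fintype V] [Fintype W] [Fintype κ]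
    [DecidableEq κ] (hVW : Fintype.card V = Fintype.card W) (c : V → κ) (c' : W → κ) :
    ∃ e : V ≃ W, #{v | c v ≠ c' (e v)} ≤ ∑ a, (#{v | c v = a} - #{w | c' w = a}) := by
  classical
  rcases isEmpty_or_nonempty V with hV | ⟨⟨v₀⟩⟩
  · exact ⟨Fintype.equivOfCardEq hVW, by simp⟩
  have : Nonempty W := ⟨Fintype.equivOfCardEq hVW v₀⟩
  -- In each colour, as many vertices as the smaller class allows are matched injectively. The
  -- matching extends to a bijection, which can err only on unmatched vertices; the truncated
  -- subtraction counts these.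
  have hex (a : κ) : ∃ (S : Finset V) (f : V → W), S ⊆ ({v | c v = a} : Finset V) ∧
      #S = min #{v | c v = a} #{w | c' w = a} ∧ (∀ v ∈ S, c' (f v) = a) ∧
      Set.InjOn f (S : Set V) := by
    obtain ⟨S, hS, hcard⟩ := exists_subset_card_eq
      (min_le_left #{v | c v = a} #{w | c' w = a})
    obtain ⟨f, hf, hinj⟩ := (S.finite_toSet).exists_injOn_of_encard_le
      (t := (({w | c' w = a} : Finset W) : Set W)) (by
        rw [Set.encard_coe_eq_coe_finsetCard, Set.encard_coe_eq_coe_finsetCard, hcard]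
        exact_mod_cast min_le_right _ _)
    refine ⟨S, f, hS, hcard, fun v hv => ?_, hinj⟩
    simpa using hf hv
  choose S f hS hcard hcol hinj using hex
  set T : Finset V := {v | v ∈ S (c v)} with hT
  obtain ⟨g, hg⟩ := exists_equiv_extend_of_card_eq (t := (univ : Finset W)) (s := T)
    (f := fun v => f (c v) v) (by simpa using hVW) (subset_univ _) (by
      intro v hv w hw hvw
      have hv' : v ∈ S (c v) := by simpa [hT] using hv
      have hw' : w ∈ S (c w) := by simpa [hT] using hw
      have hvw' : f (c v) v = f (c w) w := hvw
      have hcvw : c v = c w := by rw [← hcol _ v hv', ← hcol _ w hw', hvw']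
      rw [← hcvw] at hw' hvw'
      exact hinj _ hv' hw' hvw')
  let e : V ≃ W := g.trans ((Equiv.subtypeUnivEquiv fun w => mem_univ w))
  refine ⟨e, ?_⟩
  have hsub : ({v | c v ≠ c' (e v)} : Finset V) ⊆ Tᶜ := by
    intro v hv
    simp only [mem_filter, mem_univ, true_and] at hv
    rw [mem_compl]
    intro hvT
    have h1 : e v = f (c v) v := hg v hvT
    exact hv (by rw [h1, hcol _ v (by simpa [hT] using hvT)])
  refine (card_le_card hsub).trans ?_
  rw [card_eq_sum_card_fiberwise (f := c) (t := univ) (fun _ _ => by simp)]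
  refine sum_le_sum fun a _ => ?_
  have h1 : ({v ∈ Tᶜ | c v = a} : Finset V) = ({v | c v = a} : Finset V) \ S a := by
    ext v
    simp only [mem_filter, mem_compl, Finset.mem_sdiff, mem_univ, true_and, hT]
    constructor
    · rintro ⟨h1, rfl⟩; exact ⟨rfl, h1⟩
    · rintro ⟨rfl, h1⟩; exact ⟨h1, rfl⟩
  rw [h1, card_sdiff_of_subset (hS a), hcard]
  omega

/-- The colouring of the vertices of the Turán graph by its parts. -/
def turanColor (n : ℕ) {r : ℕ} (hr : 1 ≤ r) (i : Fin n) : Fin r := ⟨i % r, Nat.mod_lt _ hr⟩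

lemma card_turanColor (n : ℕ) {r : ℕ} (hr : 1 ≤ r) (a : Fin r) :
    (n / r : ℝ) - 1 ≤ #{i | turanColor n hr i = a} ∧
      (#{i | turanColor n hr i = a} : ℝ) ≤ n / r + 1 := by
  have h1 : #{i | turanColor n hr i = a} = n / r + if (a : ℕ) % r < n % r then 1 else 0 := by
    rw [← Nat.count_modEq_card n hr (a : ℕ), Nat.count_eq_card_filter_range]
    refine card_bij (fun i _ => i) ?_ (fun i _ j _ h => Fin.ext h) ?_
    · intro i hi
      simp only [mem_filter, mem_univ, true_and, turanColor, Fin.ext_iff] at hi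
      simp [Nat.ModEq, hi, Nat.mod_eq_of_lt a.2]
    · intro i hi
      simp only [mem_filter, mem_range, Nat.ModEq, Nat.mod_eq_of_lt a.2] at hi
      exact ⟨⟨i, hi.1⟩, by simp [turanColor, Fin.ext_iff, hi.2], rfl⟩
  have hr0 : (0 : ℝ) < r := by exact_mod_cast hr
  have h2 : ((n / r : ℕ) : ℝ) ≤ (n / r : ℝ) := Nat.cast_div_le
  have h3 : (n / r : ℝ) ≤ ((n / r : ℕ) : ℝ) + 1 := by
    rw [div_le_iff₀ hr0]
    have := Nat.lt_div_mul_add (a := n) hr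
    have h4 : (n : ℝ) < (n / r : ℕ) * r + r := by exact_mod_cast this
    linarith
  rw [h1]
  push_cast
  constructor <;> split_ifs <;> norm_num <;> linarith

lemma sum_sum_ite_eq {V κ : Type*} [Fintype V] [Fintype κ] [DecidableEq κ] (c : V → κ) :
    ∑ x, ∑ y, (if c x = c y then (1 : ℝ) else 0) = ∑ a, (#{v | c v = a} : ℝ) ^ 2 := by
  have h1 (x : V) : ∑ y, (if c x = c y then (1 : ℝ) else 0) = #{v | c v = c x} := by
    simp only [sum_boole, eq_comm]
  simp only [h1]
  rw [← sum_fiberwise_of_maps_to (g := c) (t := univ) (fun _ _ => mem_univ _)]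
  refine sum_congr rfl fun a _ => ?_
  rw [sum_congr rfl (g := fun _ => (#{v | c v = a} : ℝ))]
  · rw [sum_const, nsmul_eq_mul, sq]
  · intro x hx
    rw [(mem_filter.mp hx).2]

lemma adjInd_turanGraph {n r : ℕ} (hr : 1 ≤ r) (i j : Fin n) :
    adjInd (turanGraph n r) i j =
      1 - if turanColor n hr i = turanColor n hr j then (1 : ℝ) else 0 := by
  simp only [adjInd, turanGraph_adj, turanColor, Fin.mk.injEq]
  by_cases h : (i : ℕ) % r = j % r <;> simp [h]

/-- If a graph has few monochromatic edges for some `r`-colouring and nearly as many edges as the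
Turán graph, then it is close to the Turán graph. -/
lemma exists_equiv_sum_abs_le {V : Type*} [Fintype V] (G : SimpleGraph V) {r : ℕ} (hr : 1 ≤ r)
    {κ ξ : ℝ} (hξ : 0 ≤ ξ) (hκξ : 2 * κ * r ≤ ξ ^ 2) (c : V → Fin r)
    (hmono : ∑ x, ∑ y, (if c x = c y then adjInd G x y else 0) ≤ κ * (Fintype.card V : ℝ) ^ 2)
    (hdens : (1 - 1 / (r : ℝ) - κ) * (Fintype.card V : ℝ) ^ 2 ≤ ∑ x, ∑ y, adjInd G x y) :
    ∃ e : V ≃ Fin (Fintype.card V),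
      ∑ x, ∑ y, |adjInd G x y - adjInd (turanGraph (Fintype.card V) r) (e x) (e y)| ≤
        3 * κ * (Fintype.card V : ℝ) ^ 2
          + 2 * (Fintype.card V * (ξ * Fintype.card V + r)) := by
  classical
  set n := Fintype.card V with hn
  have hr0 : (0 : ℝ) < r := by exact_mod_cast hr
  obtain ⟨e, he⟩ := exists_equiv_card_ne_le (by simp [hn]) c (turanColor n hr)
  refine ⟨e, ?_⟩
  set D : Finset V := {v | c v ≠ turanColor n hr (e v)} with hD
  set k : V → V → ℝ := fun x y => if c x = c y then 1 else 0 with hk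
  set W : ℝ := ∑ a, (#{v | c v = a} : ℝ) ^ 2 with hW
  have hkW : ∑ x, ∑ y, k x y = W := sum_sum_ite_eq c
  have hsumn : ∑ a, (#{v | c v = a} : ℝ) = n := by
    rw [← Nat.cast_sum, ← card_eq_sum_card_fiberwise (fun _ _ => by simp), card_univ]
  have hkg (x y : V) : (if c x = c y then adjInd G x y else 0) = k x y * adjInd G x y := by
    simp [hk]
  simp only [hkg] at hmono
  have hgle : ∑ x, ∑ y, adjInd G x y ≤ κ * n ^ 2 + (n ^ 2 - W) := by
    have h1 (x y : V) : adjInd G x y ≤ k x y * adjInd G x y + (1 - k x y) := by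
      have := adjInd_le_one G x y
      simp only [hk]; split_ifs <;> linarith
    calc _ ≤ ∑ x, ∑ y, (k x y * adjInd G x y + (1 - k x y)) :=
          sum_le_sum fun x _ => sum_le_sum fun y _ => h1 x y
      _ = ∑ x, ∑ y, k x y * adjInd G x y + (n ^ 2 - W) := by
          simp only [sum_add_distrib, sum_sub_distrib, hkW, sum_const, card_univ, ← hn,
            nsmul_eq_mul]
          ring
      _ ≤ _ := by linarith
  have hWlow : (1 / (r : ℝ)) * n ^ 2 ≤ W := by
    have := sq_sum_le_card_mul_sum_sq (s := (univ : Finset (Fin r)))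
      (f := fun a => (#{v | c v = a} : ℝ))
    rw [hsumn, card_univ, Fintype.card_fin] at this
    rw [div_mul_eq_mul_div, one_mul, div_le_iff₀ hr0]
    linarith
  -- Cauchy–Schwarz applied to the variance Σ(|V_a| - n/r)² = W - n²/r. This is at most 2κn², since
  -- a large `W` would leave too few pairs between the classes for the edges of `G`.
  have hdev : ∑ a, |(#{v | c v = a} : ℝ) - n / r| ≤ ξ * n := by
    refine abs_le_of_sq_le_sq' (a := ∑ a, |(#{v | c v = a} : ℝ) - n / r|) ?_ (by positivity) |>.2
    calc _ ≤ (r : ℝ) * ∑ a, |(#{v | c v = a} : ℝ) - n / r| ^ 2 := by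
          simpa using sq_sum_le_card_mul_sum_sq (s := (univ : Finset (Fin r)))
            (f := fun a => |(#{v | c v = a} : ℝ) - n / r|)
      _ = r * (W - 1 / r * n ^ 2) := by
          simp only [sq_abs, sub_sq, sum_add_distrib, sum_sub_distrib, ← mul_sum, ← sum_mul, hsumn,
            sum_const, card_univ, Fintype.card_fin, nsmul_eq_mul, ← hW]
          field_simp
          ring
      _ ≤ r * (2 * κ * n ^ 2) := by
          refine mul_le_mul_of_nonneg_left ?_ hr0.le
          linarith
      _ = (2 * κ * r) * n ^ 2 := by ring
      _ ≤ ξ ^ 2 * n ^ 2 := mul_le_mul_of_nonneg_right hκξ (by positivity)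
      _ = (ξ * n) ^ 2 := by ring
  have hDcard : (#D : ℝ) ≤ ξ * n + r := by
    calc (#D : ℝ) ≤ ∑ a, ((#{v | c v = a} - #{w | turanColor n hr w = a} : ℕ) : ℝ) := by
          exact_mod_cast he
      _ ≤ ∑ a, (|(#{v | c v = a} : ℝ) - n / r| + 1) := by
          refine sum_le_sum fun a _ => ?_
          have h1 := (card_turanColor n hr a).1
          have h2 := le_abs_self ((#{v | c v = a} : ℝ) - n / r)
          have h3 := abs_nonneg ((#{v | c v = a} : ℝ) - n / r)
          rcases le_total #{w | turanColor n hr w = a} #{v | c v = a} with h | h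
          · rw [Nat.cast_sub h]; linarith
          · rw [Nat.sub_eq_zero_of_le h]; push_cast; linarith
      _ ≤ _ := by
          simp only [sum_add_distrib, sum_const, card_univ, Fintype.card_fin, nsmul_eq_mul]
          linarith
  -- Outside `D` the Turán indicator is 1 - k, and the difference is g if k = 1 and 1 - g if k = 0,
  -- where g is the indicator of `G`; both equal 2kg + (1 - k) - g. This form is linear in sums
  -- already bounded.
  have hpt (x y : V) : |adjInd G x y - adjInd (turanGraph n r) (e x) (e y)| ≤
      (2 * (k x y * adjInd G x y) + (1 - k x y) - adjInd G x y) +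
        ((if x ∈ D then (1 : ℝ) else 0) + if y ∈ D then (1 : ℝ) else 0) := by
    rw [adjInd_turanGraph hr]
    have h0 := adjInd_nonneg G x y
    have h1 := adjInd_le_one G x y
    have hDm (v : V) : v ∈ D ↔ c v ≠ turanColor n hr (e v) := by simp [hD]
    by_cases hx : x ∈ D
    · rw [if_pos hx, abs_le]
      simp only [hk]
      constructor <;> split_ifs <;> linarith
    · by_cases hy : y ∈ D
      · rw [if_neg hx, if_pos hy, abs_le]
        simp only [hk]
        constructor <;> split_ifs <;> linarith
      · rw [if_neg hx, if_neg hy]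
        rw [hDm, not_not] at hx hy
        rw [← hx, ← hy, abs_le]
        simp only [hk]
        constructor <;> split_ifs <;> linarith
  calc _ ≤ ∑ x, ∑ y, ((2 * (k x y * adjInd G x y) + (1 - k x y) - adjInd G x y) +
        ((if x ∈ D then (1 : ℝ) else 0) + if y ∈ D then (1 : ℝ) else 0)) :=
        sum_le_sum fun x _ => sum_le_sum fun y _ => hpt x y
    _ = 2 * ∑ x, ∑ y, k x y * adjInd G x y + (n ^ 2 - W) - ∑ x, ∑ y, adjInd G x y
        + 2 * (n * #D) := by
        simp only [sum_add_distrib, sum_sub_distrib, ← mul_sum, hkW, sum_const, card_univ, ← hn,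
          nsmul_eq_mul, sum_ite_mem, univ_inter]
        ring
    _ ≤ 3 * κ * n ^ 2 + 2 * (n * (ξ * n + r)) := by
        have : (n : ℝ) * #D ≤ n * (ξ * n + r) :=
          mul_le_mul_of_nonneg_left hDcard (Nat.cast_nonneg _)
        linarith

/-- **Stability**: a dense graph without a large complete `(r + 1)`-partite subgraph is close to
the Turán graph. -/
lemma exists_close_to_turanGraph {r s : ℕ} (hr : 1 ≤ r) (hs : 1 ≤ s) {ε : ℝ} (hε : 0 < ε) :
    ∃ ε' : ℝ, 0 < ε' ∧ ∃ N : ℕ, ∀ (V : Type u) [Fintype V] (G : SimpleGraph V),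
      N ≤ Fintype.card V → ¬ completeEquipartiteGraph (r + 1) s ⊑ G →
      (1 - 1 / (r : ℝ) - ε') * (Fintype.card V : ℝ) ^ 2 ≤ ∑ x, ∑ y, adjInd G x y →
      ∃ e : V ≃ Fin (Fintype.card V),
        ∑ x, ∑ y, |adjInd G x y - adjInd (turanGraph (Fintype.card V) r) (e x) (e y)| ≤
          ε * (Fintype.card V : ℝ) ^ 2 := by
  have hr0 : (0 : ℝ) < r := by exact_mod_cast hr
  -- With ξ = ε/8 the error is at most (3/8 + 2/8)εn² + 2rn, and the last term is at most εn²/4 once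
  -- n ≥ 8r/ε.
  set κ : ℝ := min (ε / 8) ((ε / 8) ^ 2 / (2 * r)) with hκ
  have hκ0 : 0 < κ := by rw [hκ]; positivity
  have hκ1 : κ ≤ ε / 8 := min_le_left _ _
  have hκ2 : 2 * κ * r ≤ (ε / 8) ^ 2 := by
    have : κ ≤ (ε / 8) ^ 2 / (2 * r) := min_le_right _ _
    rw [le_div_iff₀ (by positivity)] at this
    linarith
  obtain ⟨ε₁, hε₁, N, hN⟩ := exists_coloring.{u} (s := s) hr hs hκ0
  obtain ⟨M, hM⟩ := exists_nat_gt (8 * r / ε)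
  refine ⟨min ε₁ κ, lt_min hε₁ hκ0, max N M, fun V _ G hn hG hdens => ?_⟩
  simp only [max_le_iff] at hn
  have hn2 : (0 : ℝ) ≤ (Fintype.card V : ℝ) ^ 2 := by positivity
  obtain ⟨c, hc⟩ := hN V G hn.1 hG (le_trans (mul_le_mul_of_nonneg_right
    (by linarith [min_le_left ε₁ κ]) hn2) hdens)
  obtain ⟨e, he⟩ := exists_equiv_sum_abs_le G hr (ξ := ε / 8) (by positivity) hκ2 c hc
    (le_trans (mul_le_mul_of_nonneg_right (by linarith [min_le_right ε₁ κ]) hn2) hdens)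
  refine ⟨e, he.trans ?_⟩
  have hMn : (M : ℝ) ≤ Fintype.card V := by exact_mod_cast hn.2
  rw [div_lt_iff₀ hε] at hM
  have h1 : 8 * (r : ℝ) ≤ Fintype.card V * ε :=
    hM.le.trans (mul_le_mul_of_nonneg_right hMn hε.le)
  have h2 : (Fintype.card V : ℝ) * (8 * r) ≤ Fintype.card V * (Fintype.card V * ε) :=
    mul_le_mul_of_nonneg_left h1 (Nat.cast_nonneg _)
  have h3 : κ * (Fintype.card V : ℝ) ^ 2 ≤ ε / 8 * (Fintype.card V : ℝ) ^ 2 :=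
    mul_le_mul_of_nonneg_right hκ1 hn2
  have h4 : 0 ≤ ε * (Fintype.card V : ℝ) ^ 2 := by positivity
  linarith

/-! ### Edit distance and fractional overlays. -/

lemma two_mul_ncard_symmDiff {V : Type*} [Fintype V] (G H : SimpleGraph V) :
    2 * ((symmDiff G.edgeSet H.edgeSet).ncard : ℝ) = ∑ x, ∑ y, |adjInd G x y - adjInd H x y| := by
  have h : symmDiff G.edgeSet H.edgeSet = (symmDiff G H).edgeSet := by
    simp only [symmDiff, edgeSet_sup, edgeSet_sdiff, Set.sup_eq_union]
  rw [h, ← sum_sum_adjInd]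
  refine sum_congr rfl fun x _ => sum_congr rfl fun y _ => ?_
  by_cases h1 : G.Adj x y <;> by_cases h2 : H.Adj x y <;> simp [adjInd, symmDiff, h1, h2]

lemma adjInd_comap {V W : Type*} (G : SimpleGraph W) (f : V → W) (x y : V) :
    adjInd (G.comap f) x y = adjInd G (f x) (f y) := rfl

/-- Any pair of matrices with too small marginals can be completed to a fractional overlay. -/
lemma exists_overlay_ge {V W : Type*} [Fintype V] [Fintype W] [Nonempty V] [Nonempty W]
    (B : V → W → ℝ) (hB : ∀ i g, 0 ≤ B i g)
    (hrow : ∀ i, ∑ g, B i g ≤ 1 / (Fintype.card V : ℝ))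
    (hcol : ∀ g, ∑ i, B i g ≤ 1 / (Fintype.card W : ℝ)) :
    ∃ A : V → W → ℝ, IsFractionalOverlay A ∧ ∀ i g, B i g ≤ A i g := by
  set ρ : V → ℝ := fun i => 1 / (Fintype.card V : ℝ) - ∑ g, B i g with hρ
  set σ : W → ℝ := fun g => 1 / (Fintype.card W : ℝ) - ∑ i, B i g with hσ
  have hρ0 (i) : 0 ≤ ρ i := sub_nonneg.mpr (hrow i)
  have hσ0 (g) : 0 ≤ σ g := sub_nonneg.mpr (hcol g)
  set τ : ℝ := ∑ i, ρ i with hτ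
  have hV : (Fintype.card V : ℝ) ≠ 0 := by simp
  have hW : (Fintype.card W : ℝ) ≠ 0 := by simp
  have hτσ : ∑ g, σ g = τ := by
    simp only [hτ, hρ, hσ, sum_sub_distrib, sum_const, card_univ, nsmul_eq_mul]
    rw [sum_comm, mul_one_div_cancel hV, mul_one_div_cancel hW]
  have hτ0 : 0 ≤ τ := sum_nonneg fun i _ => hρ0 i
  -- If τ = 0 then all deficits vanish, and the convention x / 0 = 0 gives the right value.
  have hρτ (i) : ρ i * τ / τ = ρ i := by
    by_cases h : τ = 0
    · rw [h, div_zero]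
      exact ((sum_eq_zero_iff_of_nonneg fun i _ => hρ0 i).mp (hτ ▸ h) i (mem_univ i)).symm
    · exact mul_div_cancel_right₀ _ h
  have hστ (g) : τ * σ g / τ = σ g := by
    by_cases h : τ = 0
    · rw [h, div_zero]
      exact ((sum_eq_zero_iff_of_nonneg fun g _ => hσ0 g).mp (hτσ.trans h) g (mem_univ g)).symm
    · exact mul_div_cancel_left₀ _ h
  -- Row and column deficits have the same total τ, so their normalised product fills both exactly.
  refine ⟨fun i g => B i g + ρ i * σ g / τ, ⟨fun i g => ?_, fun i => ?_, fun g => ?_⟩,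
    fun i g => ?_⟩
  · have := hB i g; have := hρ0 i; have := hσ0 g; positivity
  · rw [sum_add_distrib, ← sum_div, ← mul_sum, hτσ, hρτ]; simp [hρ]
  · rw [sum_add_distrib, ← sum_div, ← sum_mul, ← hτ, hστ]; simp [hσ]
  · have := hρ0 i; have := hσ0 g
    have : 0 ≤ ρ i * σ g / τ := by positivity
    linarith

section Cost

variable {V W : Type*} [Fintype V] [Fintype W]

lemma deltaOne_le_overlayCost (G : SimpleGraph V) (H : SimpleGraph W) {A : V → W → ℝ}
    (hA : IsFractionalOverlay A) : deltaOne G H ≤ overlayCost G H A := by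
  refine csInf_le ⟨0, ?_⟩ ⟨A, hA, rfl⟩
  rintro _ ⟨A, hA, rfl⟩
  refine sum_nonneg fun i _ => sum_nonneg fun j _ => sum_nonneg fun g _ => sum_nonneg fun h _ => ?_
  split_ifs
  · exact mul_nonneg (hA.1 _ _) (hA.1 _ _)
  · exact le_rfl

lemma sum_overlay [Nonempty V] {A : V → W → ℝ} (hA : IsFractionalOverlay A) :
    ∑ i, ∑ g, A i g = 1 := by
  simp [hA.2.1]

open Classical in
/-- Bound on the cost of an overlay by a triangle inequality. -/
lemma overlayCost_le [Nonempty V] [Nonempty W] (G : SimpleGraph V) (H : SimpleGraph W)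
    {A : V → W → ℝ} (hA : IsFractionalOverlay A) (p : V → V → ℝ) (q : W → W → ℝ) (D : V → W → ℝ)
    (h : ∀ i j g h, |adjInd G i j - adjInd H g h| ≤ p i j + q g h + D i g + D j h) :
    overlayCost G H A ≤ (∑ i, ∑ j, p i j) / (Fintype.card V : ℝ) ^ 2
      + (∑ g, ∑ h, q g h) / (Fintype.card W : ℝ) ^ 2 + 2 * ∑ i, ∑ g, D i g * A i g := by
  have h1 : overlayCost G H A ≤ ∑ i, ∑ j, ∑ g, ∑ h,
      (p i j * (A i g * A j h) + q g h * (A i g * A j h) + (D i g * A i g) * A j h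
        + A i g * (D j h * A j h)) := by
    refine sum_le_sum fun i _ => sum_le_sum fun j _ => sum_le_sum fun g _ => sum_le_sum fun k _ => ?_
    -- The Xor indicator is the absolute difference of the adjacency indicators. After the bound
    -- `h`, every fourfold sum factors through row sums, column sums or the total mass 1.
    have hAA : 0 ≤ A i g * A j k := mul_nonneg (hA.1 _ _) (hA.1 _ _)
    have h2 : (if Xor (G.Adj i j) (H.Adj g k) then A i g * A j k else 0)
        ≤ |adjInd G i j - adjInd H g k| * (A i g * A j k) := by
      by_cases h1 : G.Adj i j <;> by_cases h2 : H.Adj g k <;> simp [adjInd, h1, h2]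
    refine h2.trans ((mul_le_mul_of_nonneg_right (h i j g k) hAA).trans (le_of_eq ?_))
    ring
  refine h1.trans (le_of_eq ?_)
  simp only [sum_add_distrib]
  have e1 : ∑ i, ∑ j, ∑ g, ∑ h, p i j * (A i g * A j h)
      = (∑ i, ∑ j, p i j) / (Fintype.card V : ℝ) ^ 2 := by
    simp only [← mul_sum, ← sum_mul, hA.2.1]
    rw [div_eq_mul_inv]
    congr 1
    field_simp
  have e2 : ∑ i, ∑ j, ∑ g, ∑ h, q g h * (A i g * A j h)
      = (∑ g, ∑ h, q g h) / (Fintype.card W : ℝ) ^ 2 := by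
    calc _ = ∑ g, ∑ h, ∑ i, ∑ j, q g h * (A i g * A j h) := by
          rw [sum_congr rfl fun i _ => sum_comm, sum_comm]
          refine sum_congr rfl fun g _ => ?_
          rw [sum_congr rfl fun i _ => sum_comm, sum_comm]
      _ = _ := by
          simp only [← mul_sum, ← sum_mul, hA.2.2]
          rw [div_eq_mul_inv]
          congr 1
          field_simp
  have e3 : ∑ i, ∑ j, ∑ g, ∑ h, (D i g * A i g) * A j h = ∑ i, ∑ g, D i g * A i g := by
    simp only [← mul_sum, ← sum_mul]
    simp only [sum_overlay hA, mul_one]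
  have e4 : ∑ i, ∑ j, ∑ g, ∑ h, A i g * (D j h * A j h) = ∑ i, ∑ g, D i g * A i g := by
    simp only [← mul_sum, ← sum_mul]
    simp only [sum_overlay hA, one_mul]
  rw [e1, e2, e3, e4]
  ring

end Cost

/-- The partitions of two Turán graphs with the same number of parts can be overlaid almost
perfectly. -/
lemma exists_overlay_turanColor {V W : Type*} [Fintype V] [Fintype W] [Nonempty V] [Nonempty W]
    {n m r : ℕ} (hr : 1 ≤ r) (e : V ≃ Fin n) (f : W ≃ Fin m) (hrn : r ≤ n) (hrm : r ≤ m) :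
    ∃ A : V → W → ℝ, IsFractionalOverlay A ∧
      ∑ i, ∑ g, (if turanColor n hr (e i) = turanColor m hr (f g) then 0 else 1) * A i g
        ≤ 2 * (r : ℝ) / n + 2 * r / m := by
  have hV : Fintype.card V = n := by simpa using Fintype.card_congr e
  have hW : Fintype.card W = m := by simpa using Fintype.card_congr f
  have hr0 : (0 : ℝ) < r := by exact_mod_cast hr
  have hn0 : (0 : ℝ) < n := by exact_mod_cast hr.trans hrn
  have hm0 : (0 : ℝ) < m := by exact_mod_cast hr.trans hrm
  have hrn' : (r : ℝ) ≤ n := by exact_mod_cast hrn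
  have hrm' : (r : ℝ) ≤ m := by exact_mod_cast hrm
  set c := fun i => turanColor n hr (e i) with hc
  set d := fun g => turanColor m hr (f g) with hd
  have hcc (a) : #{i | c i = a} = #{i | turanColor n hr i = a} := card_equiv e (by simp [hc])
  have hdd (a) : #{g | d g = a} = #{i | turanColor m hr i = a} := card_equiv f (by simp [hd])
  -- Classes have at most m/r + 1 and n/r + 1 vertices, so this weight on equally coloured pairs
  -- keeps the marginals at most 1/(n + r) and 1/(m + r). It still carries mass at least (n - r)(m -
  -- r)/((n + r)(m + r)).
  set β : ℝ := r / ((n + r) * (m + r)) with hβ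
  have hβ0 : 0 ≤ β := by positivity
  obtain ⟨A, hA, hBA⟩ := exists_overlay_ge (fun i g => if c i = d g then β else 0)
    (fun i g => by positivity) (fun i => by
      have h1 : ∑ g, (if c i = d g then β else 0) = #{g | d g = c i} * β := by
        rw [← sum_filter, sum_const, nsmul_eq_mul]
        simp only [eq_comm]
      rw [h1, hdd, hV]
      calc _ ≤ (m / r + 1) * β := mul_le_mul_of_nonneg_right (card_turanColor m hr _).2 hβ0
        _ = 1 / (n + r) := by rw [hβ]; field_simp
        _ ≤ 1 / n := one_div_le_one_div_of_le hn0 (by linarith)) (fun g => by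
      have h1 : ∑ i, (if c i = d g then β else 0) = #{i | c i = d g} * β := by
        rw [← sum_filter, sum_const, nsmul_eq_mul]
      rw [h1, hcc, hW]
      calc _ ≤ (n / r + 1) * β := mul_le_mul_of_nonneg_right (card_turanColor n hr _).2 hβ0
        _ = 1 / (m + r) := by rw [hβ]; field_simp
        _ ≤ 1 / m := one_div_le_one_div_of_le hm0 (by linarith))
  refine ⟨A, hA, ?_⟩
  have hdiag : (1 - 2 * (r : ℝ) / (n + r)) * (1 - 2 * r / (m + r)) ≤
      ∑ i, ∑ g, (if c i = d g then β else 0) := by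
    have h1 : ∑ i, ∑ g, (if c i = d g then β else 0)
        = ∑ a, (#{i | c i = a} : ℝ) * (#{g | d g = a} * β) := by
      have h2 (i) : ∑ g, (if c i = d g then β else 0) = #{g | d g = c i} * β := by
        rw [← sum_filter, sum_const, nsmul_eq_mul]
        simp only [eq_comm]
      simp only [h2]
      rw [← sum_fiberwise_of_maps_to (g := c) (t := univ) (fun _ _ => mem_univ _)]
      refine sum_congr rfl fun a _ => ?_
      rw [sum_congr rfl (g := fun _ => (#{g | d g = a} : ℝ) * β)]
      · rw [sum_const, nsmul_eq_mul]
      · intro x hx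
        rw [(mem_filter.mp hx).2]
    rw [h1]
    have hnr : (0 : ℝ) ≤ n / r - 1 := by rw [sub_nonneg, one_le_div hr0]; exact hrn'
    have hmr : (0 : ℝ) ≤ m / r - 1 := by rw [sub_nonneg, one_le_div hr0]; exact hrm'
    calc _ = ∑ a : Fin r, ((n / r - 1 : ℝ) * ((m / r - 1) * β)) := by
          rw [sum_const, card_univ, Fintype.card_fin, nsmul_eq_mul, hβ]
          field_simp
          ring
      _ ≤ _ := by
          refine sum_le_sum fun a _ => ?_
          rw [hcc, hdd]
          have h2 := (card_turanColor n hr a).1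
          have h3 := (card_turanColor m hr a).1
          gcongr
  have hoff : ∑ i, ∑ g, (if c i = d g then 0 else 1) * A i g
      ≤ 1 - ∑ i, ∑ g, (if c i = d g then β else 0) := by
    rw [le_sub_iff_add_le, ← sum_add_distrib]
    refine le_trans (sum_le_sum fun i _ => ?_) (sum_overlay hA).le
    rw [← sum_add_distrib]
    refine sum_le_sum fun g _ => ?_
    have := hBA i g
    split_ifs at this ⊢ <;> linarith
  refine hoff.trans ?_
  have h1 : 2 * (r : ℝ) / (n + r) ≤ 2 * r / n := by gcongr; linarith
  have h2 : 2 * (r : ℝ) / (m + r) ≤ 2 * r / m := by gcongr; linarith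
  have h3 : 0 ≤ 2 * (r : ℝ) / (n + r) * (2 * r / (m + r)) := by positivity
  linarith

/-! ### Edge density and its extremal value. -/

lemma edgeDensity_eq {V : Type u} [Fintype V] (G : SimpleGraph V) :
    edgeDensity.{u}.val V G = (∑ x, ∑ y, adjInd G x y) / (Fintype.card V : ℝ) ^ 2 := by
  rw [sum_sum_adjInd]; rfl

lemma edgeDensity_le_one {V : Type u} [Fintype V] (G : SimpleGraph V) :
    edgeDensity.{u}.val V G ≤ 1 := by
  rw [edgeDensity_eq]
  refine div_le_one_of_le₀ ?_ (by positivity)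
  calc _ ≤ ∑ x : V, ∑ y : V, (1 : ℝ) :=
        sum_le_sum fun x _ => sum_le_sum fun y _ => adjInd_le_one G x y
    _ = _ := by simp [sq]

lemma edgeDensity_le_extremalValue (P : GraphProperty.{u}) {V : Type u} [Fintype V]
    {G : SimpleGraph V} (hG : P.Holds V G) :
    edgeDensity.{u}.val V G ≤ extremalValue edgeDensity.{u} P (Fintype.card V) := by
  refine le_csSup ⟨1, ?_⟩ ⟨V, inferInstance, G, rfl, hG, rfl⟩
  rintro _ ⟨V, _, G, _, _, rfl⟩
  exact edgeDensity_le_one G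

/-- Classes have at most n/r + 1 vertices, so at most (n/r + 1)n ordered pairs, the diagonal
included, lie within a class. -/
lemma le_edgeDensity_turanGraph {V : Type u} [Fintype V] {n r : ℕ} (hr : 1 ≤ r)
    (e : V ≃ Fin n) (hn : 1 ≤ n) :
    1 - 1 / (r : ℝ) - 1 / n ≤ edgeDensity.{u}.val V ((turanGraph n r).comap e) := by
  rw [edgeDensity_eq, Fintype.card_congr e, Fintype.card_fin]
  have hn0 : (0 : ℝ) < n := by exact_mod_cast hn
  have hr0 : (0 : ℝ) < r := by exact_mod_cast hr
  rw [le_div_iff₀ (by positivity)]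
  have h1 : ∑ x, ∑ y, adjInd ((turanGraph n r).comap e) x y
      = ∑ i : Fin n, ∑ j : Fin n, adjInd (turanGraph n r) i j := by
    rw [← Equiv.sum_comp e]
    refine sum_congr rfl fun x _ => ?_
    rw [← Equiv.sum_comp e]
    rfl
  have h2 : ∑ a, (#{i | turanColor n hr i = a} : ℝ) = n := by
    rw [← Nat.cast_sum, ← card_eq_sum_card_fiberwise (fun _ _ => by simp), card_univ,
      Fintype.card_fin]
  have h3 : ∑ a, (#{i | turanColor n hr i = a} : ℝ) ^ 2 ≤ (n / r + 1) * n := by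
    rw [← h2, mul_sum]
    refine sum_le_sum fun a _ => ?_
    rw [sq]
    rw [h2]
    exact mul_le_mul_of_nonneg_right (card_turanColor n hr a).2 (Nat.cast_nonneg _)
  rw [h1]
  simp only [adjInd_turanGraph hr, sum_sub_distrib, sum_sum_ite_eq, sum_const, card_univ,
    Fintype.card_fin, nsmul_eq_mul]
  have h4 : (1 - 1 / (r : ℝ) - 1 / n) * n ^ 2 = n * (n * 1) - (n / r + 1) * n := by
    field_simp
    ring
  linarith

/-! ### Forbidden families and stability. -/

section Family

variable {ι : Type w} {W : ι → Type v} [∀ i, Finite (W i)] (F : ∀ i, SimpleGraph (W i))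

/-- The minimum exists even for infinite families, by well-foundedness. It is finite since the
graphs are finite, and at least 2 since they have edges. -/
lemma exists_chromaticNumber_eq [Nonempty ι] (hF : ∀ i, F i ≠ ⊥) :
    ∃ r : ℕ, 1 ≤ r ∧ ∃ i₀, (F i₀).chromaticNumber = ((r + 1 : ℕ) : ℕ∞) ∧
      ∀ i, ((r + 1 : ℕ) : ℕ∞) ≤ (F i).chromaticNumber := by
  obtain ⟨_, ⟨i₀, rfl⟩, hmin⟩ := (wellFounded_lt (α := ℕ∞)).has_min
    (Set.range fun i => (F i).chromaticNumber) (Set.range_nonempty _)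
  have hle (i) : (F i₀).chromaticNumber ≤ (F i).chromaticNumber := not_lt.mp (hmin _ ⟨i, rfl⟩)
  have hne : (F i₀).chromaticNumber ≠ ⊤ := by
    have := Fintype.ofFinite (W i₀)
    exact chromaticNumber_ne_top_iff_exists.mpr ⟨_, colorable_of_fintype _⟩
  obtain ⟨k, hk⟩ := ENat.ne_top_iff_exists.mp hne
  have h2 : (2 : ℕ∞) ≤ (F i₀).chromaticNumber := by
    obtain ⟨x, y, hxy⟩ := ne_bot_iff_exists_adj.mp (hF i₀)
    exact two_le_chromaticNumber_of_adj hxy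
  have hk2 : 2 ≤ k := by rw [← hk] at h2; exact_mod_cast h2
  obtain ⟨r, rfl⟩ : ∃ r, k = r + 1 := ⟨k - 1, by omega⟩
  exact ⟨r, by omega, i₀, hk.symm, fun i => hk ▸ hle i⟩

omit [∀ i, Finite (W i)] in
lemma isFamilyFree_turanGraph {V : Type u} {n r : ℕ} (hr : 1 ≤ r)
    (hχ : ∀ i, ((r + 1 : ℕ) : ℕ∞) ≤ (F i).chromaticNumber) (e : V ≃ Fin n) :
    IsFamilyFree F ((turanGraph n r).comap e) := by
  rintro i ⟨f⟩
  have hcol : ((turanGraph n r).comap e).Colorable r :=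
    ⟨Coloring.mk (fun v => turanColor n hr (e v)) fun {v w} h h' => h (by
      simpa [turanColor] using h')⟩
  have h := (hχ i).trans (hcol.of_hom f.toHom).chromaticNumber_le
  have : r + 1 ≤ r := by exact_mod_cast h
  omega

/-- A proper colouring with r + 1 colours embeds `F i₀` in K_{r+1}(s) as soon as `s` bounds the
class sizes; s = |W i₀| does. -/
lemma exists_not_isContained {r : ℕ} (i₀ : ι) (hF : F i₀ ≠ ⊥)
    (hχ : (F i₀).chromaticNumber = ((r + 1 : ℕ) : ℕ∞)) :
    ∃ s, 1 ≤ s ∧ ∀ (V : Type u) (G : SimpleGraph V), IsFamilyFree F G →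
      ¬ completeEquipartiteGraph (r + 1) s ⊑ G := by
  classical
  have := Fintype.ofFinite (W i₀)
  obtain ⟨C⟩ := chromaticNumber_le_iff_colorable.mp hχ.le
  obtain ⟨x, -⟩ := ne_bot_iff_exists_adj.mp hF
  refine ⟨Fintype.card (W i₀), Fintype.card_pos_iff.mpr ⟨x⟩, fun V G hG h => hG i₀ ?_⟩
  exact (isContained_completeEquipartiteGraph_of_colorable C _
    fun c => Fintype.card_subtype_le _).trans h

/-- Almost extremal graphs are close to the Turán graph with one part less than the smallest
chromatic number of the family. -/
lemma exists_close_to_turanGraph_of_isFamilyFree (hF : ∀ i, F i ≠ ⊥) {r : ℕ} (hr : 1 ≤ r)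
    {i₀ : ι} (hχ : (F i₀).chromaticNumber = ((r + 1 : ℕ) : ℕ∞)) {ε : ℝ} (hε : 0 < ε) :
    ∃ ε' : ℝ, 0 < ε' ∧ ∃ N : ℕ, ∀ (V : Type u) [Fintype V] (G : SimpleGraph V),
      N ≤ Fintype.card V → IsFamilyFree F G →
      (1 - 1 / (r : ℝ) - ε') * (Fintype.card V : ℝ) ^ 2 ≤ ∑ x, ∑ y, adjInd G x y →
      ∃ e : V ≃ Fin (Fintype.card V),
        ∑ x, ∑ y, |adjInd G x y - adjInd (turanGraph (Fintype.card V) r) (e x) (e y)| ≤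
          ε * (Fintype.card V : ℝ) ^ 2 := by
  obtain ⟨s, hs, hfree⟩ := exists_not_isContained.{u} F i₀ (hF i₀) hχ
  obtain ⟨ε', hε', N, hN⟩ := exists_close_to_turanGraph.{u} hr hs hε
  exact ⟨ε', hε', N, fun V _ G hn hG => hN V G hn (hfree V G hG)⟩

/-- The Turán graph is free, so almost extremal graphs have density near 1 - 1/r and lie close to
Turán graphs. The overlay then costs at most ε/8 for each graph and twice ε/8 + ε/8 for misaligned
colours, 3ε/4 in all. -/
lemma isStableProblem_of_chromaticNumber (hF : ∀ i, F i ≠ ⊥) {r : ℕ} (hr : 1 ≤ r)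
    {i₀ : ι} (hχ : (F i₀).chromaticNumber = ((r + 1 : ℕ) : ℕ∞))
    (hmin : ∀ i, ((r + 1 : ℕ) : ℕ∞) ≤ (F i).chromaticNumber) :
    IsStableProblem.{u} edgeDensity.{u} (Forb.{u} F) := by
  intro ε hε
  obtain ⟨ε₁, hε₁, N, hN⟩ := exists_close_to_turanGraph_of_isFamilyFree.{u} F hF hr hχ
    (show 0 < ε / 8 by positivity)
  have hr0 : (0 : ℝ) < r := by exact_mod_cast hr
  obtain ⟨M₁, hM₁⟩ := exists_nat_gt (2 / ε₁)
  obtain ⟨M₂, hM₂⟩ := exists_nat_gt (16 * r / ε)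
  have close (V : Type u) [Fintype V] (G : SimpleGraph V)
      (hn : max (max N M₁) (max M₂ r) ≤ Fintype.card V) (hG : IsFamilyFree F G)
      (hdens : extremalValue edgeDensity.{u} (Forb.{u} F) (Fintype.card V) - ε₁ / 2
        ≤ edgeDensity.{u}.val V G) :
      ∃ e : V ≃ Fin (Fintype.card V),
        (∑ x, ∑ y, |adjInd G x y - adjInd (turanGraph (Fintype.card V) r) (e x) (e y)|)
          / (Fintype.card V : ℝ) ^ 2 ≤ ε / 8 ∧
        2 * (r : ℝ) / Fintype.card V ≤ ε / 8 := by
    simp only [max_le_iff] at hn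
    have hn1 : 1 ≤ Fintype.card V := hr.trans hn.2.2
    have hn0 : (0 : ℝ) < Fintype.card V := by exact_mod_cast hn1
    let e₀ := Fintype.equivFin V
    have h1 := le_edgeDensity_turanGraph hr e₀ hn1
    have h2 := edgeDensity_le_extremalValue (Forb.{u} F)
      (isFamilyFree_turanGraph F hr hmin e₀)
    have h3 : 1 / (Fintype.card V : ℝ) ≤ ε₁ / 2 := by
      have : (M₁ : ℝ) ≤ Fintype.card V := by exact_mod_cast hn.1.2
      rw [div_lt_iff₀ hε₁] at hM₁
      rw [div_le_iff₀ hn0]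
      nlinarith
    have h4 : 1 - 1 / (r : ℝ) - ε₁ ≤ edgeDensity.{u}.val V G := by linarith
    rw [edgeDensity_eq, le_div_iff₀ (by positivity)] at h4
    obtain ⟨e, he⟩ := hN V G hn.1.1 hG h4
    refine ⟨e, by rwa [div_le_iff₀ (by positivity)], ?_⟩
    have : (M₂ : ℝ) ≤ Fintype.card V := by exact_mod_cast hn.2.1
    rw [div_lt_iff₀ hε] at hM₂
    rw [div_le_iff₀ hn0]
    nlinarith
  refine ⟨ε₁ / 2, by positivity, max (max N M₁) (max M₂ r), ?_⟩
  intro V₁ V₂ _ _ G₁ G₂ hn₁ hn₂ hG₁ hG₂ hd₁ hd₂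
  obtain ⟨e, he, hre⟩ := close V₁ G₁ hn₁ hG₁ hd₁
  obtain ⟨f, hf, hrf⟩ := close V₂ G₂ hn₂ hG₂ hd₂
  simp only [max_le_iff] at hn₁ hn₂
  have : Nonempty V₁ := Fintype.card_pos_iff.mp (hr.trans hn₁.2.2)
  have : Nonempty V₂ := Fintype.card_pos_iff.mp (hr.trans hn₂.2.2)
  obtain ⟨A, hA, hoff⟩ := exists_overlay_turanColor hr e f hn₁.2.2 hn₂.2.2
  have hcost := overlayCost_le G₁ G₂ hA
    (fun x y => |adjInd G₁ x y - adjInd (turanGraph (Fintype.card V₁) r) (e x) (e y)|)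
    (fun x y => |adjInd G₂ x y - adjInd (turanGraph (Fintype.card V₂) r) (f x) (f y)|)
    (fun i g => if turanColor _ hr (e i) = turanColor _ hr (f g) then 0 else 1) (by
      intro i j g h
      have h1 : |adjInd (turanGraph (Fintype.card V₁) r) (e i) (e j)
          - adjInd (turanGraph (Fintype.card V₂) r) (f g) (f h)| ≤
          (if turanColor _ hr (e i) = turanColor _ hr (f g) then (0 : ℝ) else 1)
          + if turanColor _ hr (e j) = turanColor _ hr (f h) then 0 else 1 := by
        rw [adjInd_turanGraph hr, adjInd_turanGraph hr]
        by_cases hi : turanColor _ hr (e i) = turanColor _ hr (f g)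
        · by_cases hj : turanColor _ hr (e j) = turanColor _ hr (f h)
          · simp [hi, hj]
          · rw [if_pos hi, if_neg hj, abs_le]
            constructor <;> split_ifs <;> norm_num
        · rw [if_neg hi, abs_le]
          constructor <;> split_ifs <;> norm_num
      have h2 := abs_sub_le (adjInd G₁ i j)
        (adjInd (turanGraph (Fintype.card V₁) r) (e i) (e j)) (adjInd G₂ g h)
      have h3 := abs_sub_le (adjInd (turanGraph (Fintype.card V₁) r) (e i) (e j))
        (adjInd (turanGraph (Fintype.card V₂) r) (f g) (f h)) (adjInd G₂ g h)
      rw [abs_sub_comm (adjInd (turanGraph (Fintype.card V₂) r) (f g) (f h)) (adjInd G₂ g h)] at h3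
      linarith)
  have := deltaOne_le_overlayCost G₁ G₂ hA
  linarith

-- The complete graph is now admissible, so almost extremal graphs miss at most ε/4 of all ordered
-- pairs, and every overlay costs at most ε/2.
omit [∀ i, Finite (W i)] in
lemma isStableProblem_of_isEmpty [IsEmpty ι] :
    IsStableProblem.{u} edgeDensity.{u} (Forb.{u} F) := by
  intro ε hε
  obtain ⟨M, hM⟩ := exists_nat_gt (8 / ε)
  have close (V : Type u) [Fintype V] (G : SimpleGraph V) (hn : max 1 M ≤ Fintype.card V)
      (hdens : extremalValue edgeDensity.{u} (Forb.{u} F) (Fintype.card V) - ε / 8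
        ≤ edgeDensity.{u}.val V G) :
      (∑ x, ∑ y, (1 - adjInd G x y)) / (Fintype.card V : ℝ) ^ 2 ≤ ε / 4 := by
    classical
    simp only [max_le_iff] at hn
    have hn0 : (0 : ℝ) < Fintype.card V := by exact_mod_cast hn.1
    have h1 := edgeDensity_le_extremalValue (Forb.{u} F) (V := V) (G := ⊤) (fun i => isEmptyElim i)
    have h2 : edgeDensity.{u}.val V (⊤ : SimpleGraph V) = 1 - 1 / Fintype.card V := by
      rw [edgeDensity_eq]
      have h3 (x y : V) : adjInd (⊤ : SimpleGraph V) x y = 1 - if x = y then 1 else 0 := by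
        by_cases h : x = y <;> simp [adjInd, h]
      simp only [h3, sum_sub_distrib, sum_const, card_univ, nsmul_eq_mul, sum_ite_eq, mem_univ,
        if_true]
      field_simp
    have h3 : 1 / (Fintype.card V : ℝ) ≤ ε / 8 := by
      have : (M : ℝ) ≤ Fintype.card V := by exact_mod_cast hn.2
      rw [div_lt_iff₀ hε] at hM
      rw [div_le_iff₀ hn0]
      nlinarith
    have h4 : (∑ x, ∑ y, (1 - adjInd G x y)) / (Fintype.card V : ℝ) ^ 2
        = 1 - edgeDensity.{u}.val V G := by
      rw [edgeDensity_eq]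
      simp only [sum_sub_distrib, sum_const, card_univ, nsmul_eq_mul]
      field_simp
    linarith
  refine ⟨ε / 8, by positivity, max 1 M, ?_⟩
  intro V₁ V₂ _ _ G₁ G₂ hn₁ hn₂ _ _ hd₁ hd₂
  have h1 := close V₁ G₁ hn₁ hd₁
  have h2 := close V₂ G₂ hn₂ hd₂
  have : Nonempty V₁ := Fintype.card_pos_iff.mp (le_of_max_le_left hn₁)
  have : Nonempty V₂ := Fintype.card_pos_iff.mp (le_of_max_le_left hn₂)
  obtain ⟨A, hA, -⟩ := exists_overlay_ge (V := V₁) (W := V₂) (fun _ _ => 0) (fun _ _ => le_rfl)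
    (fun _ => by simp) (fun _ => by simp)
  have hcost := overlayCost_le G₁ G₂ hA (fun x y => 1 - adjInd G₁ x y)
    (fun x y => 1 - adjInd G₂ x y) (fun _ _ => 0) (by
      intro i j g h
      have := adjInd_le_one G₁ i j
      have := adjInd_le_one G₂ g h
      rw [abs_le]
      constructor <;> linarith)
  have := deltaOne_le_overlayCost G₁ G₂ hA
  simp only [zero_mul, sum_const_zero, mul_zero, add_zero] at hcost
  linarith

end Family

end ErdosSimonovits

open ErdosSimonovits in
theorem theorem1 {ι : Type w} {W : ι → Type v} [∀ i, Finite (W i)]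
    (F : ∀ i, SimpleGraph (W i)) (hF : ∀ i, F i ≠ ⊥) :
    IsStableProblem.{u} edgeDensity.{u} (Forb.{u} F) ∧
    (Nonempty ι →
      ∃ r : ℕ, 1 ≤ r ∧
        IsLeast (Set.range fun i => (F i).chromaticNumber) ((r + 1 : ℕ) : ℕ∞) ∧
        ∀ ε : ℝ, 0 < ε → ∃ ε' : ℝ, 0 < ε' ∧ ∃ n₀ : ℕ,
          ∀ (V : Type u) [Fintype V] (G : SimpleGraph V),
            n₀ ≤ Fintype.card V → IsFamilyFree F G →
            (((r : ℝ) - 1) / r - ε') * ((Fintype.card V).choose 2 : ℝ) ≤ (G.edgeSet.ncard : ℝ) →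
            ∃ H : SimpleGraph V,
              Nonempty (H ≃g SimpleGraph.turanGraph (Fintype.card V) r) ∧
              ((symmDiff G.edgeSet H.edgeSet).ncard : ℝ) ≤
                ε * ((Fintype.card V).choose 2 : ℝ)) := by
  refine ⟨?_, fun hι => ?_⟩
  · rcases isEmpty_or_nonempty ι with hι | hι
    · exact isStableProblem_of_isEmpty F
    · obtain ⟨r, hr, i₀, hχ, hmin⟩ := exists_chromaticNumber_eq F hF
      exact isStableProblem_of_chromaticNumber F hF hr hχ hmin
  obtain ⟨r, hr, i₀, hχ, hmin⟩ := exists_chromaticNumber_eq F hF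
  refine ⟨r, hr, ⟨⟨i₀, hχ⟩, by rintro _ ⟨i, rfl⟩; exact hmin i⟩, fun ε hε => ?_⟩
  obtain ⟨ε₁, hε₁, N, hN⟩ := exists_close_to_turanGraph_of_isFamilyFree.{u} F hF hr hχ
    (show 0 < ε / 2 by positivity)
  obtain ⟨M, hM⟩ := exists_nat_gt (2 / ε₁)
  refine ⟨ε₁ / 2, by positivity, max N (max M 2), fun V _ G hn hG hedges => ?_⟩
  simp only [max_le_iff] at hn
  have hr0 : (0 : ℝ) < r := by exact_mod_cast hr
  have hn2 : (2 : ℝ) ≤ Fintype.card V := by exact_mod_cast hn.2.2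
  have hMn : (M : ℝ) ≤ Fintype.card V := by exact_mod_cast hn.2.1
  rw [Nat.cast_choose_two] at hedges ⊢
  set n : ℝ := (Fintype.card V : ℝ) with hndef
  have hq : ((r : ℝ) - 1) / r = 1 - 1 / r := by field_simp
  rw [hq] at hedges
  have hq1 : 1 - 1 / (r : ℝ) ≤ 1 := by
    have : 0 < 1 / (r : ℝ) := by positivity
    linarith
  rw [div_lt_iff₀ hε₁] at hM
  -- Passing from n(n - 1) to n² loses at most n ≤ ε₁n²/2, which the other half of ε₁ covers.
  have h1 : 2 ≤ n * ε₁ := by nlinarith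
  have h2 : (1 - 1 / (r : ℝ) - ε₁ / 2) * n ≤ 1 * n :=
    mul_le_mul_of_nonneg_right (by linarith) (by linarith)
  have h3 : 2 * n ≤ n * ε₁ * n := mul_le_mul_of_nonneg_right h1 (by linarith)
  obtain ⟨e, he⟩ := hN V G hn.1 hG (by rw [sum_sum_adjInd]; linarith)
  refine ⟨(SimpleGraph.turanGraph (Fintype.card V) r).comap e, ⟨SimpleGraph.Iso.comap e _⟩, ?_⟩
  have h4 := two_mul_ncard_symmDiff G ((SimpleGraph.turanGraph (Fintype.card V) r).comap e)
  simp only [adjInd_comap] at h4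
  rw [← h4] at he
  -- The edit distance is at most εn²/4, and n²/4 ≤ n(n - 1)/2 because n ≥ 2.
  have h5 : 0 ≤ ε * (n * (n - 2)) := by
    have : 0 ≤ n - 2 := by linarith
    positivity
  linarith
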